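/- Let $(Z,d,\mu)$ be a compact, connected metric space with a Borel regular measure $\mu$ that is Ahlfors $Q$-regular, $Q>1$: there are constants $c_0,C_0>0$ with $c_0r^Q\le\mu(B(z,r))\le C_0r^Q$ for all $z\in Z$, $0<r\le\operatorname{diam}Z$. *Hyperbolic filling.* Let $s>1$ and $R>\operatorname{diam}Z$ ($R=1$ if $Z$ is rescaled so that $\operatorname{diam}Z<1$). For each $k\ge0$ let $P_k\subseteq Z$ be a maximal $Rs^{-k}$-separated set (distinct points of $P_k$ are at distance at least $Rs^{-k}$). A hyperbolic filling $X=(V,E)$ of $Z$ with parameter $s$ is the following graph. The vertices of level $k$ are the points $p\in P_k$, with balls $B_v=B(p,2Rs^{-k})$, and $V$ is the disjoint union of the levels. Distinct vertices $v,w$ are joined by an edge if and only if their levels differ by at most $1$ and $\overline{B_v}\cap\overline{B_w}\neq\emptyset$. A sequence of vertices $v_n$ with balls $B(p_n,r_n)$ converges nontangentially to $z\in Z$ if $p_n\to z$, $r_n\to0$ and there is a constant $L>0$ with $d(z,p_n)\le L r_n$ for all $n$. *Weak capacity.* For $f\colon E\to[0,\infty]$ let $\|f\|_{Q,\infty}$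 be the infimum of all $K>0$ with $\#\{e: f(e)>\lambda\}\le K^Q/\lambda^Q$ for all $\lambda>0$ (and $\infty$ if there is no such $K$). For $A,B\subseteq Z$ call $\tau\colon E\to[0,\infty]$ admissible if $\sum_{n\in\mathbb Z}\tau(e_n)\ge1$ for every two-sided infinite edge path $(e_n)_{n\in\mathbb Z}$ in $X$ whose two ends converge nontangentially to a point of $A$ and to a point of $B$, respectively. Put $\operatorname{wcap}_Q(A,B)=\inf\{\|\tau\|_{Q,\infty}^Q:\tau\text{ admissible}\}$. *Modulus.* $\operatorname{Mod}_Q(A,B)=\inf\int_Z\rho^Q\,d\mu$ over all Borel $\rho\colon Z\to[0,\infty]$ with $\int_\gamma\rho\ge1$ (integral with respect to arclength) for every rectifiable path $\gamma$ that starts in $A$ and ends in $B$. **Theorem.** There is a constant $C>0$, depending only on $Q$, the filling parameter $s$ and the regularity constants $c_0,C_0$, such that $$\operatorname{Mod}_Q(A,B)\le C\,\operatorname{wcap}_Q(A,B)$$ whenever $A,B\subseteq Z$ are either open sets with $\operatorname{dist}(A,B)=\inf\{d(a,b):a\in A,b\in B\}>0$ or disjoint continua (a continuum being a compact connected set with more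 than one point). -/

import Mathlib

open Set Filter Topology MeasureTheory
open scoped ENNReal NNReal

noncomputable section

namespace WeakCap

/-- `μ` is Ahlfors `Q`-regular with constants `c` and `C`. -/
def IsAhlforsRegular {Z : Type*} [MetricSpace Z] [MeasurableSpace Z]
    (μ : Measure Z) (Q c C : ℝ) : Prop :=
  ∀ (z : Z) (r : ℝ), 0 < r → r ≤ Metric.diam (univ : Set Z) →
    ENNReal.ofReal (c * r ^ Q) ≤ μ (Metric.ball z r) ∧
      μ (Metric.ball z r) ≤ ENNReal.ofReal (C * r ^ Q)

/-- `dist(A, B) = inf {d(a, b) : a ∈ A, b ∈ B}`, equal to `∞` when `A` or `B` is empty. -/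
def setEDist {Z : Type*} [MetricSpace Z] (A B : Set Z) : ℝ≥0∞ :=
  ⨅ a ∈ A, ⨅ b ∈ B, edist a b

/-- A continuum is a compact connected set with more than one point. -/
def IsContinuum {Z : Type*} [MetricSpace Z] (A : Set Z) : Prop :=
  IsCompact A ∧ IsConnected A ∧ A.Nontrivial

/-! ### Modulus of path families -/

/-- A path `γ : [a, b] → Z`; only the values of `toFun` on `[a, b]` are relevant. -/
structure Curve (Z : Type*) [MetricSpace Z] where
  a : ℝ
  b : ℝ
  le : a ≤ b
  toFun : ℝ → Z
  cont : ContinuousOn toFun (Icc a b)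

namespace Curve

variable {Z : Type*} [MetricSpace Z]

/-- The length of a path. -/
def length (γ : Curve Z) : ℝ≥0∞ := eVariationOn γ.toFun (Icc γ.a γ.b)

/-- A path is rectifiable if its length is finite. -/
def Rectifiable (γ : Curve Z) : Prop := γ.length ≠ ∞

/-- The path integral of `ρ` over a (rectifiable) path, with respect to its arclength
parameterization on `[0, length γ]`. -/
def lineIntegral (γ : Curve Z) (ρ : Z → ℝ≥0∞) : ℝ≥0∞ :=
  ∫⁻ t in Icc (0 : ℝ) γ.length.toReal,
    ρ (naturalParameterization γ.toFun (Icc γ.a γ.b) γ.a t)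

end Curve

/-- A Borel function `ρ` is admissible for the path family `Γ`. -/
def ModAdmissible {Z : Type*} [MetricSpace Z] [MeasurableSpace Z]
    (Γ : Set (Curve Z)) (ρ : Z → ℝ≥0∞) : Prop :=
  Measurable ρ ∧ ∀ γ ∈ Γ, γ.Rectifiable → 1 ≤ γ.lineIntegral ρ

/-- The `p`-modulus of a path family. -/
def modulus {Z : Type*} [MetricSpace Z] [MeasurableSpace Z]
    (μ : Measure Z) (p : ℝ) (Γ : Set (Curve Z)) : ℝ≥0∞ :=
  ⨅ (ρ : Z → ℝ≥0∞) (_ : ModAdmissible Γ ρ), ∫⁻ z, ρ z ^ p ∂μ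

/-- The family of paths connecting `A` to `B`. -/
def connecting {Z : Type*} [MetricSpace Z] (A B : Set Z) : Set (Curve Z) :=
  {γ | γ.toFun γ.a ∈ A ∧ γ.toFun γ.b ∈ B}

/-- `Mod_p(A, B)`. -/
def setModulus {Z : Type*} [MetricSpace Z] [MeasurableSpace Z]
    (μ : Measure Z) (p : ℝ) (A B : Set Z) : ℝ≥0∞ :=
  modulus μ p (connecting A B)

/-- The weak `ℓ^p`-norm: the infimum of all constants `K > 0` with
`#{x : f x > t} ≤ K ^ p / t ^ p` for all `t > 0` (it is `∞` if there is no such constant). -/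
def weakNorm {X : Type*} (p : ℝ) (f : X → ℝ≥0∞) : ℝ≥0∞ :=
  ⨅ (K : ℝ≥0) (_ : 0 < K ∧ ∀ t : ℝ≥0, 0 < t →
    (({x | (t : ℝ≥0∞) < f x}.encard : ℕ∞) : ℝ≥0∞) ≤ (K : ℝ≥0∞) ^ p / (t : ℝ≥0∞) ^ p),
    (K : ℝ≥0∞)

/-! ### Hyperbolic fillings -/

/-- The data of a hyperbolic filling of `Z` with parameter `s > 1`. The number `R` is a scale with
`diam Z < R`: this is the filling of the rescaled space `(Z, d / R)`, of diameter less than `1`,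
and `R = 1` is the normalized case. For each `k`, `centers k` is a maximal
`s ^ (-k)`-separated set of the rescaled space. -/
structure HyperbolicFilling (Z : Type*) [MetricSpace Z] (s R : ℝ) where
  one_lt : 1 < s
  diam_lt : Metric.diam (univ : Set Z) < R
  centers : ℕ → Set Z
  maximal : ∀ k, Maximal (fun P : Set Z => P.Pairwise fun p q => R / s ^ k ≤ dist p q) (centers k)

namespace HyperbolicFilling

variable {Z : Type*} [MetricSpace Z] {s R : ℝ} (X : HyperbolicFilling Z s R)

/-- The vertices: the disjoint union over the levels `k` of the sets of centers. -/
def Vertex : Type _ := Σ k : ℕ, X.centers k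

variable {X}

/-- The level of a vertex. -/
def level (v : X.Vertex) : ℕ := v.1

/-- The center of the ball of a vertex. -/
def center (v : X.Vertex) : Z := v.2.1

/-- The radius `2 s ^ (-k)` (in the rescaled metric) of the ball of a vertex of level `k`. -/
def radius (v : X.Vertex) : ℝ := 2 * (R / s ^ level v)

/-- The ball `B_v` of a vertex. -/
def ball (v : X.Vertex) : Set Z := Metric.ball (center v) (radius v)

variable (X)

/-- The graph: distinct vertices are joined if their levels differ by at most one and the closures
of their balls intersect. -/
def graph : SimpleGraph X.Vertex where
  Adj v w := v ≠ w ∧ |(level v : ℤ) - (level w : ℤ)| ≤ 1 ∧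
    (closure (ball v) ∩ closure (ball w)).Nonempty
  symm := ⟨fun _ _ h => ⟨h.1.symm, by rw [abs_sub_comm]; exact h.2.1, by
    rw [inter_comm]; exact h.2.2⟩⟩
  loopless := ⟨fun _ h => h.1 rfl⟩

/-- An infinite path (in both directions) in the graph. -/
structure InfinitePath where
  vert : ℤ → X.Vertex
  adj : ∀ n, X.graph.Adj (vert n) (vert (n + 1))

variable {X}

/-- The `n`-th edge of an infinite path. -/
def InfinitePath.edge (γ : X.InfinitePath) (n : ℤ) : X.graph.edgeSet :=
  ⟨s(γ.vert n, γ.vert (n + 1)), γ.adj n⟩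

/-- A sequence of vertices converges nontangentially to `z`. -/
def ConvergesNontangentially (v : ℕ → X.Vertex) (z : Z) : Prop :=
  Tendsto (fun n => center (v n)) atTop (𝓝 z) ∧
  Tendsto (fun n => radius (v n)) atTop (𝓝 0) ∧
  ∃ C : ℝ, 0 < C ∧ ∀ n, dist z (center (v n)) ≤ C * radius (v n)

/-- The two ends of the infinite path have nontangential limits in `A` and in `B`. -/
def InfinitePath.Connects (γ : X.InfinitePath) (A B : Set Z) : Prop :=
  (∃ z ∈ A, ConvergesNontangentially (fun n : ℕ => γ.vert (-(n : ℤ))) z) ∧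
  (∃ z ∈ B, ConvergesNontangentially (fun n : ℕ => γ.vert (n : ℤ)) z)

variable (X)

/-- A function on the edges is admissible for `A` and `B`. -/
def Admissible (A B : Set Z) (τ : X.graph.edgeSet → ℝ≥0∞) : Prop :=
  ∀ γ : X.InfinitePath, γ.Connects A B → 1 ≤ ∑' n : ℤ, τ (γ.edge n)

/-- The weak `p`-capacity between `A` and `B`. -/
def wcap (p : ℝ) (A B : Set Z) : ℝ≥0∞ :=
  ⨅ (τ : X.graph.edgeSet → ℝ≥0∞) (_ : X.Admissible A B τ), weakNorm p τ ^ p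

end HyperbolicFilling

end WeakCap

end

/-! Let τ be admissible with weak bound K. For each level n, spread τ over Z: every edge e of level
n puts the value 2τ(e)/(R s^(-n)) on a ball of radius 3R s^(-n) about the center of one endpoint,
and ρ_n is the sum. Bounded overlap and Q-regularity bound ∫ρ_n^Q by a constant times the sum of τ^Q
over level n. The i-th largest value of τ^Q is at most K^Q/i and the number of edges grows
exponentially with the level, so N consecutive levels carry only O(N) K^Q in total. Hence
arbitrarily high levels have a sum at most a constant times K^Q (`WeakBound.exists_sum_rpow_le`).

Fix a rectifiable path γ from A to B. The descending ray to an end of γ may be heavy, but heavy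
edges are few and each one spoils only a short interval of distances from that end. So suitable
points of A and B near the ends have rays of weight at most 1/4 (`exists_tsum_rayEdge_le`). Joining
these rays by a walk of level n along γ, admissibility leaves mass at least 1/2 for the walk
(`Admissible.half_le_sum`). Since γ runs long enough near each edge of the walk, ∫_γ ρ_n ≥ 1.

This holds only from a level depending on γ. The paths for which it holds from level j on form an
increasing sequence of families exhausting all connecting paths up to rectifiability. Each family
has modulus at most a constant times K^Q, and Ziemer's lemma (`modulus_iUnion_le`) carries the bound
to the union. -/

noncomputable section

namespace WeakCap

/-! ### Uniform convexity and Ziemer's lemma -/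

/-- A quantitative form of the strict convexity of `t ↦ t ^ p`. -/
theorem exists_rpow_midpoint_gap {p : ℝ} (hp : 1 < p) {ε : ℝ} (hε : 0 < ε) :
    ∃ M : ℝ, 0 < M ∧ ∀ x y : ℝ, 0 ≤ x → 0 ≤ y →
      (max (y - x) 0) ^ p + M * ((x + y) / 2) ^ p ≤ ε * (x ^ p + y ^ p) +
        M * ((x ^ p + y ^ p) / 2) := by
  have hp0 : 0 < p := by linarith
  -- As `η ^ p ≤ ε`, a gap `y - x ≤ η * y` is absorbed by `ε * y ^ p`; the cap at 1 keeps `[0, 1 -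
  -- η]` nonempty.
  set η : ℝ := min (ε ^ p⁻¹) 1 with hη
  have hη0 : 0 < η := lt_min (Real.rpow_pos_of_pos hε _) one_pos
  have hηp : η ^ p ≤ ε := by
    calc η ^ p ≤ (ε ^ p⁻¹) ^ p := Real.rpow_le_rpow hη0.le (min_le_left _ _) hp0.le
      _ = ε := Real.rpow_inv_rpow hε.le hp0.ne'
  -- The convexity gap of the pair `(t, 1)`. By homogeneity the gap of `(x, y)` is `y ^ p * φ (x /
  -- y)`. Strict convexity makes φ positive on the compact interval `[0, 1 - η]`, and M is the
  -- reciprocal of its minimum there.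
  let φ : ℝ → ℝ := fun t => (t ^ p + 1) / 2 - ((t + 1) / 2) ^ p
  have hconv : ∀ x y : ℝ, 0 ≤ x → 0 ≤ y → ((x + y) / 2) ^ p ≤ (x ^ p + y ^ p) / 2 := by
    intro x y hx hy
    have := (convexOn_rpow hp.le).2 (mem_Ici.2 hx) (mem_Ici.2 hy)
      (by norm_num : (0 : ℝ) ≤ 1 / 2) (by norm_num : (0 : ℝ) ≤ 1 / 2) (by norm_num)
    simp only [smul_eq_mul] at this
    calc ((x + y) / 2) ^ p = (1 / 2 * x + 1 / 2 * y) ^ p := by congr 1; ring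
      _ ≤ _ := this
      _ = _ := by ring
  have hφpos : ∀ t ∈ Icc (0 : ℝ) (1 - η), 0 < φ t := by
    intro t ht
    have := (strictConvexOn_rpow hp).2 (mem_Ici.2 ht.1) (mem_Ici.2 zero_le_one)
      (by linarith [ht.2] : t < 1).ne
      (by norm_num : (0 : ℝ) < 1 / 2) (by norm_num : (0 : ℝ) < 1 / 2) (by norm_num)
    simp only [smul_eq_mul, Real.one_rpow] at this
    have h2 : ((t + 1) / 2) ^ p = (1 / 2 * t + 1 / 2 * 1) ^ p := by congr 1; ring
    simp only [φ, h2]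
    linarith
  have hφcont : ContinuousOn φ (Icc (0 : ℝ) (1 - η)) := by
    apply Continuous.continuousOn
    have h1 : Continuous fun t : ℝ => t ^ p := Real.continuous_rpow_const hp0.le
    exact ((h1.add continuous_const).div_const _).sub
      (h1.comp ((continuous_id.add continuous_const).div_const _))
  obtain ⟨t₀, ht₀, hmin⟩ := isCompact_Icc.exists_isMinOn
    (nonempty_Icc.2 (by linarith [min_le_right (ε ^ p⁻¹) 1] : (0 : ℝ) ≤ 1 - η)) hφcont
  have hδ := hφpos t₀ ht₀
  refine ⟨(φ t₀)⁻¹, inv_pos.2 hδ, fun x y hx hy => ?_⟩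
  have hM := inv_pos.2 hδ
  have hxp := Real.rpow_nonneg hx p
  have hyp := Real.rpow_nonneg hy p
  rcases le_or_gt (y - x) (η * y) with h | h
  · have h1 : (max (y - x) 0) ^ p ≤ ε * y ^ p := by
      calc (max (y - x) 0) ^ p ≤ (η * y) ^ p :=
            Real.rpow_le_rpow (le_max_right _ _) (max_le h (by positivity)) hp0.le
        _ = η ^ p * y ^ p := Real.mul_rpow hη0.le hy
        _ ≤ _ := by gcongr
    have h2 := mul_le_mul_of_nonneg_left (hconv x y hx hy) hM.le
    nlinarith
  · have hy0 : 0 < y := by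
      rcases hy.eq_or_lt with h0 | h0
      · subst h0; linarith
      · exact h0
    have ht : x / y ∈ Icc (0 : ℝ) (1 - η) :=
      ⟨by positivity, by rw [div_le_iff₀ hy0]; linarith⟩
    have h3 : φ t₀ ≤ φ (x / y) := hmin ht
    have h4 : y ^ p * φ (x / y) = (x ^ p + y ^ p) / 2 - ((x + y) / 2) ^ p := by
      have e1 : x ^ p = y ^ p * (x / y) ^ p := by
        rw [← Real.mul_rpow hy (by positivity)]; congr 1; field_simp
      have e2 : ((x + y) / 2) ^ p = y ^ p * ((x / y + 1) / 2) ^ p := by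
        rw [← Real.mul_rpow hy (by positivity)]; congr 1; field_simp
      simp only [φ]; rw [e1, e2]; ring
    have h5 : (max (y - x) 0) ^ p ≤ y ^ p :=
      Real.rpow_le_rpow (le_max_right _ _) (max_le (by linarith) hy) hp0.le
    have h6 : y ^ p ≤ (φ t₀)⁻¹ * ((x ^ p + y ^ p) / 2 - ((x + y) / 2) ^ p) := by
      rw [← h4, ← div_eq_inv_mul, le_div_iff₀ hδ]
      gcongr
    have : 0 ≤ ε * (x ^ p + y ^ p) := by positivity
    nlinarith

theorem exists_ennreal_rpow_midpoint_gap {p : ℝ} (hp : 1 < p) {ε : ℝ} (hε : 0 < ε) :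
    ∃ M : ℝ, 0 < M ∧ ∀ x y : ℝ≥0∞,
      (y - x) ^ p + ENNReal.ofReal M * ((x + y) / 2) ^ p ≤
        ENNReal.ofReal ε * (x ^ p + y ^ p) + ENNReal.ofReal M * ((x ^ p + y ^ p) / 2) := by
  obtain ⟨M, hM, h⟩ := exists_rpow_midpoint_gap hp hε
  have hp0 : 0 < p := by linarith
  refine ⟨M, hM, fun x y => ?_⟩
  by_cases hx : x = ∞
  · simp [hx, ENNReal.top_rpow_of_pos hp0, ENNReal.mul_top, hε]
  by_cases hy : y = ∞
  · simp [hy, ENNReal.top_rpow_of_pos hp0, ENNReal.mul_top, hε]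
  lift x to ℝ≥0 using hx
  lift y to ℝ≥0 using hy
  have h := h x y x.coe_nonneg y.coe_nonneg
  have e1 : (((y : ℝ≥0∞) - x)) = ENNReal.ofReal (max ((y : ℝ) - x) 0) := by
    rw [ENNReal.ofReal_max]
    simp [ENNReal.ofReal_sub]
  have e2 : (((x : ℝ≥0∞) + y) / 2) = ENNReal.ofReal (((x : ℝ) + y) / 2) := by
    rw [ENNReal.ofReal_div_of_pos two_pos, ENNReal.ofReal_add x.coe_nonneg y.coe_nonneg]; simp
  have e3 : ∀ z : ℝ≥0, (z : ℝ≥0∞) ^ p = ENNReal.ofReal ((z : ℝ) ^ p) := fun z => by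
    rw [← ENNReal.ofReal_rpow_of_nonneg z.coe_nonneg hp0.le]; simp
  have hxp := Real.rpow_nonneg x.coe_nonneg p
  have hyp := Real.rpow_nonneg y.coe_nonneg p
  have e4 : ((x : ℝ≥0∞) ^ p + (y : ℝ≥0∞) ^ p) / 2
      = ENNReal.ofReal (((x : ℝ) ^ p + (y : ℝ) ^ p) / 2) := by
    rw [ENNReal.ofReal_div_of_pos two_pos, ENNReal.ofReal_add hxp hyp, e3, e3]; simp
  rw [e1, e4, e2, e3 x, e3 y, ENNReal.ofReal_rpow_of_nonneg (le_max_right _ _) hp0.le,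
    ENNReal.ofReal_rpow_of_nonneg (by positivity) hp0.le, ← ENNReal.ofReal_add hxp hyp,
    ← ENNReal.ofReal_mul hM.le, ← ENNReal.ofReal_mul hM.le, ← ENNReal.ofReal_mul hε.le,
    ← ENNReal.ofReal_add (by positivity) (by positivity),
    ← ENNReal.ofReal_add (by positivity) (by positivity)]
  exact ENNReal.ofReal_le_ofReal h

/-- Nearly minimal elements of a set that is stable under midpoints are close in `L ^ p`. -/
theorem exists_lintegral_sub_rpow_le {Ω : Type*} [MeasurableSpace Ω] {μ : Measure Ω} {p : ℝ}
    (hp : 1 < p) {S : ℕ → Set (Ω → ℝ≥0∞)} (hmeas : ∀ j, ∀ f ∈ S j, Measurable f)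
    (hmid : ∀ j, ∀ f ∈ S j, ∀ g ∈ S j, (fun x => (f x + g x) / 2) ∈ S j)
    {m : ℝ≥0∞} (hm : m ≠ ∞) (hsup : m = ⨆ j, ⨅ f ∈ S j, ∫⁻ x, f x ^ p ∂μ)
    {η : ℝ≥0∞} (hη : η ≠ 0) :
    ∃ δ : ℝ≥0∞, δ ≠ 0 ∧ ∃ N, ∀ f ∈ S N, ∀ g ∈ S N, ∫⁻ x, f x ^ p ∂μ ≤ m + δ →
      ∫⁻ x, g x ^ p ∂μ ≤ m + δ → ∫⁻ x, (g x - f x) ^ p ∂μ ≤ η := by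
  obtain ⟨η', hη', hηle⟩ : ∃ η' : ℝ, 0 < η' ∧ ENNReal.ofReal η' ≤ η := by
    obtain ⟨r, hr, hr'⟩ := ENNReal.lt_iff_exists_nnreal_btwn.1 (pos_iff_ne_zero.2 hη)
    exact ⟨r, by simpa using hr, by simpa using hr'.le⟩
  have hm0 : 0 ≤ m.toReal := ENNReal.toReal_nonneg
  -- With energies at most `m + 1`, the ε-term costs at most `η' / 2`. The choice of δ makes the
  -- loss `2 * M * δ` in the convexity term at most `η' / 2` as well.
  obtain ⟨M, hM, hgap⟩ := exists_ennreal_rpow_midpoint_gap hp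
    (ε := η' / (4 * (m.toReal + 1))) (by positivity)
  set ε := η' / (4 * (m.toReal + 1)) with hε
  set δ : ℝ := min 1 (η' / (4 * M)) with hδ
  have hδ0 : 0 < δ := lt_min one_pos (by positivity)
  have hε0 : 0 < ε := by positivity
  -- The midpoint of two members of `S N` is again a member, so its energy is at least `m - δ`,
  -- which leaves little room for the difference.
  obtain ⟨N, hN⟩ : ∃ N, m ≤ (⨅ f ∈ S N, ∫⁻ x, f x ^ p ∂μ) + ENNReal.ofReal δ := by
    by_contra! hcon
    have h1 : m + ENNReal.ofReal δ ≤ m := by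
      conv_lhs => rw [hsup]
      rw [ENNReal.iSup_add]
      exact iSup_le fun j => (hcon j).le
    exact absurd h1 (not_le.2 (ENNReal.lt_add_right hm (by simpa using hδ0)))
  refine ⟨ENNReal.ofReal δ, by simpa using hδ0, N, fun f hf g hg hfm hgm => ?_⟩
  have hfM := hmeas N f hf
  have hgM := hmeas N g hg
  set d := ⨅ f ∈ S N, ∫⁻ x, f x ^ p ∂μ with hd
  have hdm : d ≤ m := by rw [hsup]; exact le_iSup (fun j => ⨅ f ∈ S j, ∫⁻ x, f x ^ p ∂μ) N
  have hmidle : d ≤ ∫⁻ x, ((f x + g x) / 2) ^ p ∂μ := iInf₂_le _ (hmid N f hf g hg)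
  have hint : (∫⁻ x, (g x - f x) ^ p ∂μ) + ENNReal.ofReal M * ∫⁻ x, ((f x + g x) / 2) ^ p ∂μ ≤
      ENNReal.ofReal ε * (∫⁻ x, f x ^ p ∂μ + ∫⁻ x, g x ^ p ∂μ) +
        ENNReal.ofReal M * ((∫⁻ x, f x ^ p ∂μ + ∫⁻ x, g x ^ p ∂μ) / 2) := by
    have hfp : Measurable fun x => f x ^ p := hfM.pow_const p
    have hgp : Measurable fun x => g x ^ p := hgM.pow_const p
    have hmp : Measurable fun x => ((f x + g x) / 2) ^ p := ((hfM.add hgM).div_const 2).pow_const p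
    have hsp : Measurable fun x => (g x - f x) ^ p := (hgM.sub hfM).pow_const p
    have hfgp : Measurable fun x => f x ^ p + g x ^ p := hfp.add hgp
    rw [← lintegral_add_left hfp, ← lintegral_const_mul _ hmp, ← lintegral_add_left hsp,
      ← lintegral_const_mul _ hfgp]
    simp only [div_eq_mul_inv _ (2 : ℝ≥0∞)]
    rw [← lintegral_mul_const _ hfgp, ← lintegral_const_mul _ (hfgp.mul_const _),
      ← lintegral_add_left (hfgp.const_mul _)]
    refine lintegral_mono fun x => ?_
    simpa only [div_eq_mul_inv] using hgap (f x) (g x)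
  have hm' : m = ENNReal.ofReal m.toReal := (ENNReal.ofReal_toReal hm).symm
  have hdtop : d ≠ ∞ := ne_top_of_le_ne_top hm hdm
  have hd' : d = ENNReal.ofReal d.toReal := (ENNReal.ofReal_toReal hdtop).symm
  have hd0 : 0 ≤ d.toReal := ENNReal.toReal_nonneg
  have hmδ : m + ENNReal.ofReal δ = ENNReal.ofReal (m.toReal + δ) := by
    rw [ENNReal.ofReal_add hm0 hδ0.le, ← hm']
  have hNr : m.toReal ≤ d.toReal + δ := by
    rw [hm', hd', ← ENNReal.ofReal_add hd0 hδ0.le] at hN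
    exact (ENNReal.ofReal_le_ofReal_iff (by positivity)).1 hN
  have hchain : (∫⁻ x, (g x - f x) ^ p ∂μ) + ENNReal.ofReal (M * d.toReal) ≤
      ENNReal.ofReal η' + ENNReal.ofReal (M * d.toReal) := by
    calc (∫⁻ x, (g x - f x) ^ p ∂μ) + ENNReal.ofReal (M * d.toReal)
        ≤ (∫⁻ x, (g x - f x) ^ p ∂μ)
            + ENNReal.ofReal M * ∫⁻ x, ((f x + g x) / 2) ^ p ∂μ := by
          rw [ENNReal.ofReal_mul hM.le, ← hd']; gcongr
      _ ≤ _ := hint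
      _ ≤ ENNReal.ofReal ε * ((m + ENNReal.ofReal δ) + (m + ENNReal.ofReal δ)) +
          ENNReal.ofReal M * (((m + ENNReal.ofReal δ) + (m + ENNReal.ofReal δ)) / 2) := by
          gcongr
      _ = ENNReal.ofReal (ε * (2 * (m.toReal + δ)) + M * (m.toReal + δ)) := by
          rw [hmδ, ENNReal.add_div, ENNReal.add_halves,
            ← ENNReal.ofReal_add (by positivity) (by positivity),
            ← ENNReal.ofReal_mul hε0.le, ← ENNReal.ofReal_mul hM.le,
            ← ENNReal.ofReal_add (by positivity) (by positivity)]
          congr 1; ring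
      _ ≤ ENNReal.ofReal (η' + M * d.toReal) := by
          apply ENNReal.ofReal_le_ofReal
          have h1 : δ ≤ 1 := min_le_left _ _
          have h2 : M * δ ≤ η' / 4 := by
            calc M * δ ≤ M * (η' / (4 * M)) := by gcongr; exact min_le_right _ _
              _ = η' / 4 := by field_simp
          have h3 : ε * (2 * (m.toReal + δ)) ≤ η' / 2 := by
            calc ε * (2 * (m.toReal + δ)) ≤ ε * (2 * (m.toReal + 1)) := by gcongr
              _ = η' / 2 := by rw [hε]; field_simp; norm_num
          nlinarith [mul_le_mul_of_nonneg_left hNr hM.le]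
      _ = _ := ENNReal.ofReal_add hη'.le (by positivity)
  exact (ENNReal.le_of_add_le_add_right ENNReal.ofReal_ne_top hchain).trans hηle

theorem lintegral_add_sum_rpow_le {Ω : Type*} [MeasurableSpace Ω] {μ : Measure Ω} {p : ℝ}
    (hp : 1 ≤ p) {f : Ω → ℝ≥0∞} (hf : Measurable f) {h : ℕ → Ω → ℝ≥0∞}
    (hh : ∀ i, Measurable (h i)) (n : ℕ) :
    (∫⁻ x, (f x + ∑ i ∈ Finset.range n, h i x) ^ p ∂μ) ^ (1 / p) ≤
      (∫⁻ x, f x ^ p ∂μ) ^ (1 / p) +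
        ∑ i ∈ Finset.range n, (∫⁻ x, h i x ^ p ∂μ) ^ (1 / p) := by
  induction n with
  | zero => simp
  | succ n ih =>
    simp only [Finset.sum_range_succ, ← add_assoc]
    refine le_trans ?_ (add_le_add_left ih _)
    exact ENNReal.lintegral_Lp_add_le
      (hf.add (Finset.measurable_fun_sum _ fun i _ => hh i)).aemeasurable (hh n).aemeasurable hp

/-- A decreasing sequence of sets stable under midpoints and with bounded infimal energies
has a majorant of all sufficiently good members, of controlled energy. -/
theorem exists_dominating_rpow {Ω : Type*} [MeasurableSpace Ω] {μ : Measure Ω} {p : ℝ}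
    (hp : 1 < p) {S : ℕ → Set (Ω → ℝ≥0∞)} (hanti : Antitone S)
    (hmeas : ∀ j, ∀ f ∈ S j, Measurable f)
    (hmid : ∀ j, ∀ f ∈ S j, ∀ g ∈ S j, (fun x => (f x + g x) / 2) ∈ S j)
    {M : ℝ≥0∞} (hM : M ≠ ∞) (hle : ∀ j, ⨅ f ∈ S j, ∫⁻ x, f x ^ p ∂μ ≤ M)
    {θ : ℝ≥0∞} (hθ : θ ≠ 0) :
    ∃ g : Ω → ℝ≥0∞, Measurable g ∧ ∫⁻ x, g x ^ p ∂μ ≤ ((M + θ) ^ (1 / p) + θ) ^ p ∧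
      ∀ j, ∃ f ∈ S j, ∀ x, f x ≤ g x := by
  have hp0 : 0 < p := by linarith
  set m := ⨆ j, ⨅ f ∈ S j, ∫⁻ x, f x ^ p ∂μ with hm
  have hmM : m ≤ M := iSup_le hle
  have hmtop : m ≠ ∞ := ne_top_of_le_ne_top hM hmM
  obtain ⟨t, ht0, htsum⟩ := ENNReal.exists_pos_sum_of_countable hθ ℕ
  have hstep : ∀ i, ∃ δ : ℝ≥0∞, δ ≠ 0 ∧ ∃ N, ∀ f ∈ S N, ∀ g ∈ S N, ∫⁻ x, f x ^ p ∂μ ≤ m + δ →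
      ∫⁻ x, g x ^ p ∂μ ≤ m + δ → ∫⁻ x, (g x - f x) ^ p ∂μ ≤ (t i : ℝ≥0∞) ^ p := fun i =>
    exists_lintegral_sub_rpow_le hp hmeas hmid hmtop hm
      (by simpa [ENNReal.rpow_eq_zero_iff, hp0, hp0.le] using (ht0 i).ne')
  choose δ hδ0 N hN using hstep
  -- Each member is compared both with its successor (tolerance `δ i`) and with its predecessor (`δ
  -- (i - 1)`), hence the two constraints; at `i = 0` they coincide.
  have hex : ∀ i : ℕ, ∃ f ∈ S (max (max (N i) (N (i - 1))) i),
      ∫⁻ x, f x ^ p ∂μ < m + min (min (δ i) (δ (i - 1))) θ := by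
    intro i
    have h1 : ⨅ f ∈ S (max (max (N i) (N (i - 1))) i), ∫⁻ x, f x ^ p ∂μ
        < m + min (min (δ i) (δ (i - 1))) θ := by
      refine lt_of_le_of_lt (le_iSup (fun j => ⨅ f ∈ S j, ∫⁻ x, f x ^ p ∂μ) _)
        (ENNReal.lt_add_right hmtop ?_)
      simp only [ne_eq, ← nonpos_iff_eq_zero, not_le, lt_min_iff]
      exact ⟨⟨pos_iff_ne_zero.2 (hδ0 _), pos_iff_ne_zero.2 (hδ0 _)⟩, pos_iff_ne_zero.2 hθ⟩
    simpa [iInf_lt_iff] using h1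
  choose f hfS hfm using hex
  have hfM : ∀ i, Measurable (f i) := fun i => hmeas _ _ (hfS i)
  have hdiff : ∀ i, ∫⁻ x, (f (i + 1) x - f i x) ^ p ∂μ ≤ (t i : ℝ≥0∞) ^ p := by
    intro i
    refine hN i _ (hanti ?_ (hfS i)) _ (hanti ?_ (hfS (i + 1))) ((hfm i).le.trans ?_)
      ((hfm (i + 1)).le.trans ?_)
    · exact (le_max_left _ _).trans (le_max_left _ _)
    · exact (le_max_right (N (i + 1)) _).trans (le_max_left _ _)
    · gcongr; exact (min_le_left _ _).trans (min_le_left _ _)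
    · gcongr; exact (min_le_left _ _).trans (min_le_right (δ (i + 1)) _)
  -- Adding only the positive parts of the increments makes `H n` increasing in n and at least `f
  -- n`, while Minkowski's inequality bounds its norm by that of `f 0` plus the summable `t i`.
  let H : ℕ → Ω → ℝ≥0∞ := fun n x => f 0 x + ∑ i ∈ Finset.range n, (f (i + 1) x - f i x)
  have hHM : ∀ n, Measurable (H n) := fun n =>
    (hfM 0).add (Finset.measurable_fun_sum _ fun i _ => (hfM (i + 1)).sub (hfM i))
  have hfH : ∀ n x, f n x ≤ H n x := by
    intro n x
    induction n with
    | zero => simp [H]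
    | succ n ih =>
      simp only [H, Finset.sum_range_succ, ← add_assoc]
      exact le_add_tsub.trans (add_le_add_left ih _)
  have hHmono : Monotone H := by
    refine monotone_nat_of_le_succ fun n x => ?_
    simp only [H, Finset.sum_range_succ, ← add_assoc]
    exact le_self_add
  have hHint : ∀ n, ∫⁻ x, H n x ^ p ∂μ ≤ ((M + θ) ^ (1 / p) + θ) ^ p := by
    intro n
    have h1 := lintegral_add_sum_rpow_le (μ := μ) hp.le (hfM 0)
      (fun i => (hfM (i + 1)).sub (hfM i)) n
    have h2 : (∫⁻ x, H n x ^ p ∂μ) ^ (1 / p) ≤ (M + θ) ^ (1 / p) + θ := by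
      refine h1.trans (add_le_add ?_ ?_)
      · gcongr
        refine (hfm 0).le.trans ?_
        gcongr
        exact min_le_right _ _
      · calc ∑ i ∈ Finset.range n, (∫⁻ x, (f (i + 1) - f i) x ^ p ∂μ) ^ (1 / p)
            ≤ ∑ i ∈ Finset.range n, (t i : ℝ≥0∞) := by
              refine Finset.sum_le_sum fun i _ => ?_
              calc (∫⁻ x, (f (i + 1) - f i) x ^ p ∂μ) ^ (1 / p)
                  ≤ ((t i : ℝ≥0∞) ^ p) ^ (1 / p) := by gcongr; exact hdiff i
                _ = t i := by rw [one_div, ENNReal.rpow_rpow_inv hp0.ne']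
          _ ≤ ∑' i, (t i : ℝ≥0∞) := ENNReal.sum_le_tsum _
          _ ≤ θ := htsum.le
    calc ∫⁻ x, H n x ^ p ∂μ = ((∫⁻ x, H n x ^ p ∂μ) ^ (1 / p)) ^ p := by
          rw [one_div, ENNReal.rpow_inv_rpow hp0.ne']
      _ ≤ _ := by gcongr
  refine ⟨fun x => ⨆ n, H n x, Measurable.iSup hHM, ?_, fun j =>
    ⟨f j, hanti (le_max_right _ _) (hfS j), fun x => (hfH j x).trans (le_iSup (fun n => H n x) j)⟩⟩
  have hpow : ∀ x, (⨆ n, H n x) ^ p = ⨆ n, H n x ^ p := fun x =>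
    (ENNReal.orderIsoRpow p hp0).map_iSup _
  simp only [hpow]
  rw [lintegral_iSup (fun n => (hHM n).pow_const p)
    (fun a b hab x => ENNReal.rpow_le_rpow (hHmono hab x) hp0.le)]
  exact iSup_le hHint

theorem Curve.lineIntegral_mono {Z : Type*} [MetricSpace Z] (γ : Curve Z) {ρ σ : Z → ℝ≥0∞}
    (h : ∀ z, ρ z ≤ σ z) : γ.lineIntegral ρ ≤ γ.lineIntegral σ :=
  lintegral_mono fun _ => h _

theorem ModAdmissible.midpoint {Z : Type*} [MetricSpace Z] [MeasurableSpace Z]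
    {Γ : Set (Curve Z)} {ρ σ : Z → ℝ≥0∞} (hρ : ModAdmissible Γ ρ) (hσ : ModAdmissible Γ σ) :
    ModAdmissible Γ fun z => (ρ z + σ z) / 2 := by
  refine ⟨(hρ.1.add hσ.1).div_const 2, fun γ hγ hr => ?_⟩
  calc (1 : ℝ≥0∞) = 2⁻¹ * (1 + 1) := by
        rw [one_add_one_eq_two, ENNReal.inv_mul_cancel two_ne_zero ENNReal.ofNat_ne_top]
    _ ≤ 2⁻¹ * (γ.lineIntegral ρ + γ.lineIntegral σ) := by
        gcongr
        exacts [hρ.2 γ hγ hr, hσ.2 γ hγ hr]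
    _ ≤ 2⁻¹ * γ.lineIntegral (fun z => ρ z + σ z) := by
        gcongr; exact le_lintegral_add _ _
    _ ≤ γ.lineIntegral fun z => 2⁻¹ * (ρ z + σ z) := lintegral_const_mul_le _ _
    _ = _ := by simp only [div_eq_mul_inv, mul_comm]

/-- Ziemer's lemma: the modulus of an increasing union is at most the supremum of the moduli. -/
theorem modulus_iUnion_le {Z : Type*} [MetricSpace Z] [MeasurableSpace Z] {μ : Measure Z} {p : ℝ}
    (hp : 1 < p) {Γ : ℕ → Set (Curve Z)} (hΓ : Monotone Γ) {M : ℝ≥0∞}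
    (h : ∀ j, modulus μ p (Γ j) ≤ M) : modulus μ p (⋃ j, Γ j) ≤ M := by
  by_cases hM : M = ∞
  · simp [hM]
  have hp0 : 0 < p := by linarith
  -- A function dominating an admissible density for every `Γ j` is admissible for the union; the
  -- slack θ then tends to 0.
  have key : ∀ θ : ℝ≥0∞, θ ≠ 0 → modulus μ p (⋃ j, Γ j) ≤ ((M + θ) ^ (1 / p) + θ) ^ p := by
    intro θ hθ
    obtain ⟨g, hg, hgint, hdom⟩ := exists_dominating_rpow (μ := μ) hp
      (S := fun j => {ρ | ModAdmissible (Γ j) ρ})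
      (fun i j hij ρ hρ => ⟨hρ.1, fun γ hγ => hρ.2 γ (hΓ hij hγ)⟩) (fun _ _ hρ => hρ.1)
      (fun _ _ hρ _ hσ => hρ.midpoint hσ) hM h hθ
    refine (iInf₂_le g ⟨hg, fun γ hγ hr => ?_⟩).trans hgint
    obtain ⟨j, hj⟩ := mem_iUnion.1 hγ
    obtain ⟨f, hf, hfg⟩ := hdom j
    exact (hf.2 γ hj hr).trans (γ.lineIntegral_mono hfg)
  have hcont : Continuous fun θ : ℝ≥0∞ => ((M + θ) ^ (1 / p) + θ) ^ p :=
    ENNReal.continuous_rpow_const.comp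
      ((ENNReal.continuous_rpow_const.comp (continuous_const.add continuous_id)).add continuous_id)
  have hlim : Tendsto (fun θ : ℝ≥0∞ => ((M + θ) ^ (1 / p) + θ) ^ p) (𝓝[>] 0) (𝓝 M) := by
    have := (hcont.tendsto 0).mono_left (nhdsWithin_le_nhds (s := Ioi 0))
    simpa [ENNReal.rpow_inv_rpow hp0.ne'] using this
  refine ge_of_tendsto hlim ?_
  filter_upwards [self_mem_nhdsWithin] with θ hθ
  exact key θ (ne_of_gt hθ)

/-! ### Arclength parameterization and time spent in balls -/

theorem continuousOn_variationOnFromTo {Z : Type*} [PseudoMetricSpace Z] {f : ℝ → Z} {s : Set ℝ}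
    (hf : ContinuousOn f s) (hbv : LocallyBoundedVariationOn f s) {a : ℝ} (ha : a ∈ s) :
    ContinuousOn (variationOnFromTo f s a) s := by
  intro x hx
  -- A one-sided jump of the variation equals the corresponding jump of f, which vanishes by
  -- continuity.
  have h1 := variationOnFromTo.tendsto_left ha hx hbv
    ((hf x hx).mono_left (nhdsWithin_mono x inter_subset_left))
  have h2 := variationOnFromTo.tendsto_right ha hx hbv
    ((hf x hx).mono_left (nhdsWithin_mono x inter_subset_left))
  rw [dist_self, sub_zero] at h1
  rw [dist_self, add_zero] at h2
  have hs : s ⊆ (s ∩ Iio x) ∪ (s ∩ Ioi x) ∪ {x} := by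
    intro y hy
    rcases lt_trichotomy y x with h | h | h <;> simp [hy, h]
  refine Tendsto.mono_left ?_ (nhdsWithin_mono x hs)
  rw [nhdsWithin_union, nhdsWithin_union, nhdsWithin_singleton]
  exact (h1.sup h2).sup (tendsto_pure_nhds _ _)

namespace Curve

variable {Z : Type*} [MetricSpace Z] (γ : Curve Z)

/-- The arclength parameterization of a path. -/
def arc : ℝ → Z := naturalParameterization γ.toFun (Icc γ.a γ.b) γ.a

variable {γ}

theorem image_variationOnFromTo (h : γ.Rectifiable) :
    variationOnFromTo γ.toFun (Icc γ.a γ.b) γ.a '' Icc γ.a γ.b = Icc 0 γ.length.toReal := by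
  have hbv : LocallyBoundedVariationOn γ.toFun (Icc γ.a γ.b) :=
    BoundedVariationOn.locallyBoundedVariationOn h
  have ha : γ.a ∈ Icc γ.a γ.b := left_mem_Icc.2 γ.le
  have hb : γ.b ∈ Icc γ.a γ.b := right_mem_Icc.2 γ.le
  have h0 := variationOnFromTo.self γ.toFun (Icc γ.a γ.b) γ.a
  have h1 : variationOnFromTo γ.toFun (Icc γ.a γ.b) γ.a γ.b = γ.length.toReal := by
    rw [variationOnFromTo.eq_of_le _ _ γ.le, inter_self]; rfl
  have hmono := variationOnFromTo.monotoneOn hbv ha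
  apply Subset.antisymm
  · rintro _ ⟨x, hx, rfl⟩
    exact ⟨h0 ▸ hmono ha hx hx.1, h1 ▸ hmono hx hb hx.2⟩
  · have := intermediate_value_Icc γ.le (continuousOn_variationOnFromTo γ.cont hbv ha)
    rwa [h0, h1] at this

theorem exists_arc_eq (h : γ.Rectifiable) {x : ℝ} (hx : x ∈ Icc γ.a γ.b) :
    ∃ t ∈ Icc 0 γ.length.toReal, γ.arc t = γ.toFun x := by
  refine ⟨variationOnFromTo γ.toFun (Icc γ.a γ.b) γ.a x, ?_, ?_⟩
  · rw [← image_variationOnFromTo h]; exact mem_image_of_mem _ hx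
  · exact edist_eq_zero.1 (edist_naturalParameterization_eq_zero
      (BoundedVariationOn.locallyBoundedVariationOn h) (left_mem_Icc.2 γ.le) hx)

theorem lipschitzOnWith_arc (h : γ.Rectifiable) :
    LipschitzOnWith 1 γ.arc (Icc 0 γ.length.toReal) := by
  have hu := has_unit_speed_naturalParameterization γ.toFun
    (BoundedVariationOn.locallyBoundedVariationOn h) (left_mem_Icc.2 γ.le)
  rw [image_variationOnFromTo h] at hu
  intro x hx y hy
  wlog hxy : x ≤ y generalizing x y
  · rw [edist_comm, edist_comm x]; exact this hy hx (le_of_not_ge hxy)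
  have h1 := hu hx hy
  rw [NNReal.coe_one, one_mul] at h1
  rw [ENNReal.coe_one, one_mul, edist_comm x, edist_dist y, Real.dist_eq, abs_of_nonneg (by linarith),
    ← h1]
  exact eVariationOn.edist_le _ ⟨hx, le_rfl, hxy⟩ ⟨hy, hxy, le_rfl⟩

theorem measurableSet_arc_mem (h : γ.Rectifiable) {U : Set Z} (hU : IsOpen U) :
    MeasurableSet (γ.arc ⁻¹' U ∩ Icc 0 γ.length.toReal) := by
  obtain ⟨u, hu, hu'⟩ := continuousOn_iff'.1 (lipschitzOnWith_arc h).continuousOn U hU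
  rw [hu']
  exact hu.measurableSet.inter measurableSet_Icc

/-- A path that meets `ball z r₁` and leaves `ball z r₂` spends at least length `r₂ - r₁` in
the latter. -/
theorem le_volume_arc_mem_ball (h : γ.Rectifiable) {z : Z} {r₁ r₂ x y : ℝ}
    (hx : x ∈ Icc γ.a γ.b) (hy : y ∈ Icc γ.a γ.b) (hxz : dist (γ.toFun x) z ≤ r₁)
    (hyz : r₂ ≤ dist (γ.toFun y) z) :
    ENNReal.ofReal (r₂ - r₁) ≤ volume (γ.arc ⁻¹' Metric.ball z r₂ ∩ Icc 0 γ.length.toReal) := by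
  obtain ⟨t, ht, htx⟩ := exists_arc_eq h hx
  obtain ⟨u, hu, huy⟩ := exists_arc_eq h hy
  have hl := lipschitzOnWith_arc h
  set W := γ.arc ⁻¹' Metric.ball z r₂ ∩ Icc 0 γ.length.toReal
  let g : ℝ → ℝ := fun t => dist (γ.arc t) z
  have hg : LipschitzOnWith 1 g (Icc 0 γ.length.toReal) := by
    have := (LipschitzWith.dist_left z).comp_lipschitzOnWith hl
    simpa [g, Function.comp_def] using this
  -- By the intermediate value theorem the distance to z takes every value in `[r₁, r₂)` inside the
  -- ball; being 1-Lipschitz in arclength, it cannot enlarge measure.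
  have hsub : Ico r₁ r₂ ⊆ g '' W := by
    intro c hc
    obtain ⟨w, hw, hwc⟩ := isPreconnected_Icc.intermediate_value ht hu hg.continuousOn
      (⟨by simpa only [g, htx] using hxz.trans hc.1, by
        simpa only [g, huy] using hc.2.le.trans hyz⟩ : c ∈ Icc (g t) (g u))
    exact ⟨w, ⟨by simpa [g] using hwc.trans_lt hc.2, hw⟩, hwc⟩
  calc ENNReal.ofReal (r₂ - r₁) = volume (Ico r₁ r₂) := Real.volume_Ico.symm
    _ ≤ volume (g '' W) := measure_mono hsub
    _ ≤ volume W := by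
      have := (hg.mono inter_subset_right : LipschitzOnWith 1 g W).hausdorffMeasure_image_le
        zero_le_one
      simpa [hausdorffMeasure_real] using this

theorem le_lineIntegral_indicator_ball (h : γ.Rectifiable) {z : Z} {r₁ r₂ x y : ℝ}
    (hx : x ∈ Icc γ.a γ.b) (hy : y ∈ Icc γ.a γ.b) (hxz : dist (γ.toFun x) z ≤ r₁)
    (hyz : r₂ ≤ dist (γ.toFun y) z) (c : ℝ≥0∞) :
    c * ENNReal.ofReal (r₂ - r₁) ≤
      γ.lineIntegral ((Metric.ball z r₂).indicator fun _ => c) := by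
  have hm := measurableSet_arc_mem h (U := Metric.ball z r₂) Metric.isOpen_ball
  calc c * ENNReal.ofReal (r₂ - r₁)
      ≤ c * volume (γ.arc ⁻¹' Metric.ball z r₂ ∩ Icc 0 γ.length.toReal) := by
        gcongr; exact le_volume_arc_mem_ball h hx hy hxz hyz
    _ = ∫⁻ t in Icc 0 γ.length.toReal,
          (γ.arc ⁻¹' Metric.ball z r₂ ∩ Icc 0 γ.length.toReal).indicator (fun _ => c) t := by
        rw [lintegral_indicator_const hm, Measure.restrict_apply hm, inter_assoc, inter_self]
    _ ≤ ∫⁻ t in Icc 0 γ.length.toReal, (Metric.ball z r₂).indicator (fun _ => c) (γ.arc t) := by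
        refine lintegral_mono fun t => ?_
        by_cases ht : t ∈ γ.arc ⁻¹' Metric.ball z r₂ ∩ Icc 0 γ.length.toReal
        · rw [indicator_of_mem ht]
          rw [indicator_of_mem (show γ.arc t ∈ Metric.ball z r₂ from ht.1)]
        · rw [indicator_of_notMem ht]
          exact zero_le

/-- The lower integral is superadditive, so no measurability along the path has to be checked. -/
theorem sum_lineIntegral_le {ι : Type*} (s : Finset ι) (f : ι → Z → ℝ≥0∞) :
    ∑ i ∈ s, γ.lineIntegral (f i) ≤ γ.lineIntegral fun z => ∑ i ∈ s, f i z := by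
  classical
  induction s using Finset.induction_on with
  | empty => simp
  | insert i s hi ih =>
    simp only [Finset.sum_insert hi]
    exact (add_le_add_right ih _).trans (le_lintegral_add _ _)

end Curve

/-! ### Sums of weak `ℓ^p` functions -/

/-- `K` is an admissible constant in the definition of the weak `ℓ^p`-norm of `f`. -/
def WeakBound {X : Type*} (p : ℝ) (f : X → ℝ≥0∞) (K : ℝ≥0) : Prop :=
  ∀ t : ℝ≥0, 0 < t →
    (({x | (t : ℝ≥0∞) < f x}.encard : ℕ∞) : ℝ≥0∞) ≤ (K : ℝ≥0∞) ^ p / (t : ℝ≥0∞) ^ p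

namespace WeakBound

variable {X : Type*} {p : ℝ} {f : X → ℝ≥0∞} {K : ℝ≥0}

theorem finite (h : WeakBound p f K) (hp : 0 < p) {t : ℝ≥0} (ht : 0 < t) :
    {x | (t : ℝ≥0∞) < f x}.Finite := by
  have h1 := h t ht
  rw [← Set.encard_lt_top_iff]
  by_contra hcon
  rw [not_lt, top_le_iff] at hcon
  rw [hcon, ENat.toENNReal_top, top_le_iff] at h1
  have hK : (K : ℝ≥0∞) ^ p ≠ ∞ := ENNReal.rpow_ne_top_of_nonneg hp.le ENNReal.coe_ne_top
  have ht' : (t : ℝ≥0∞) ^ p ≠ 0 := (ENNReal.rpow_pos (by simpa using ht) ENNReal.coe_ne_top).ne'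
  exact ENNReal.div_ne_top hK ht' h1

/-- For every `t < f e` the whole of F lies in the superlevel set of t, whose size the weak bound
controls; let t increase to `f e`. -/
theorem rpow_le_div_card (h : WeakBound p f K) (hp : 0 < p) {F : Finset X} {e : X} (he : e ∈ F)
    (hmin : ∀ x ∈ F, f e ≤ f x) : f e ^ p ≤ (K : ℝ≥0∞) ^ p / F.card := by
  have hcard : (F.card : ℝ≥0∞) ≠ 0 := by simpa using Finset.ne_empty_of_mem he
  suffices f e ≤ ((K : ℝ≥0∞) ^ p / F.card) ^ p⁻¹ by
    calc f e ^ p ≤ (((K : ℝ≥0∞) ^ p / F.card) ^ p⁻¹) ^ p := by gcongr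
      _ = _ := ENNReal.rpow_inv_rpow hp.ne' _
  refine ENNReal.le_of_forall_nnreal_lt fun t ht => ?_
  rcases eq_or_ne t 0 with rfl | ht0
  · simp
  have ht1 : (t : ℝ≥0∞) ^ p ≠ 0 :=
    (ENNReal.rpow_pos (by simpa [pos_iff_ne_zero] using ht0) ENNReal.coe_ne_top).ne'
  have ht2 : (t : ℝ≥0∞) ^ p ≠ ∞ := ENNReal.rpow_ne_top_of_nonneg hp.le ENNReal.coe_ne_top
  have h1 : (F.card : ℝ≥0∞) ≤ (K : ℝ≥0∞) ^ p / (t : ℝ≥0∞) ^ p := by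
    refine le_trans ?_ (h t (pos_iff_ne_zero.2 ht0))
    have h2 : ((F : Set X).encard : ℕ∞) ≤ {x | (t : ℝ≥0∞) < f x}.encard :=
      Set.encard_le_encard fun x hx => ht.trans_le (hmin x hx)
    rw [Set.encard_coe_eq_coe_finsetCard] at h2
    exact_mod_cast ENat.toENNReal_le.2 h2
  have h3 : (t : ℝ≥0∞) ^ p ≤ (K : ℝ≥0∞) ^ p / F.card := by
    rw [ENNReal.le_div_iff_mul_le (Or.inl ht1) (Or.inl ht2)] at h1
    rw [ENNReal.le_div_iff_mul_le (Or.inl hcard) (Or.inl (ENNReal.natCast_ne_top _)), mul_comm]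
    exact h1
  calc (t : ℝ≥0∞) = ((t : ℝ≥0∞) ^ p) ^ p⁻¹ := (ENNReal.rpow_rpow_inv hp.ne' _).symm
    _ ≤ _ := by gcongr

/-- Removing a smallest element from n remaining ones costs at most `K ^ p / n`; induction produces
the harmonic sum. -/
theorem sum_rpow_le_harmonic (h : WeakBound p f K) (hp : 0 < p) (F : Finset X) :
    ∑ e ∈ F, f e ^ p ≤ (K : ℝ≥0∞) ^ p * ENNReal.ofReal ((harmonic F.card : ℚ) : ℝ) := by
  classical
  induction hn : F.card generalizing F with
  | zero => simp [Finset.card_eq_zero.1 hn]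
  | succ n ih =>
    have hF : F.Nonempty := Finset.card_pos.1 (by omega)
    obtain ⟨e, he, hmin⟩ := F.exists_min_image f hF
    have hpos : 0 ≤ ((harmonic n : ℚ) : ℝ) := by
      have : 0 ≤ harmonic n := Finset.sum_nonneg fun i _ => by positivity
      exact_mod_cast this
    have h1 := h.rpow_le_div_card hp he hmin
    rw [← Finset.sum_erase_add _ _ he, harmonic_succ, Rat.cast_add,
      ENNReal.ofReal_add hpos (by positivity), mul_add]
    refine add_le_add (ih _ (by rw [Finset.card_erase_of_mem he, hn]; rfl)) (h1.trans_eq ?_)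
    rw [hn, div_eq_mul_inv]
    congr 1
    rw [Rat.cast_inv, ENNReal.ofReal_inv_of_pos (by positivity)]
    congr 1
    rw [Rat.cast_natCast, ENNReal.ofReal_natCast]

/-- Along a disjoint sequence of finite sets of exponential growth, infinitely many of the
`ℓ^p`-sums of a weak `ℓ^p` function are controlled by its weak norm. -/
theorem exists_sum_rpow_le (h : WeakBound p f K) (hp : 0 < p) (hK : 0 < K) {E : ℕ → Finset X}
    (hE : Pairwise fun m n => Disjoint (E m) (E n)) {A β : ℝ} (hA : 0 < A) (hβ : 0 < β)
    {j : ℕ} (hcard : ∀ n, j ≤ n → ((E n).card : ℝ) ≤ A * Real.exp (β * n)) :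
    ∃ n, j ≤ n ∧ ∑ e ∈ E n, f e ^ p ≤ ENNReal.ofReal (2 * β) * (K : ℝ≥0∞) ^ p := by
  classical
  by_contra! hcon
  have hKp0 : (K : ℝ≥0∞) ^ p ≠ 0 :=
    (ENNReal.rpow_pos (by simpa using hK) ENNReal.coe_ne_top).ne'
  have hKp : (K : ℝ≥0∞) ^ p ≠ ∞ := ENNReal.rpow_ne_top_of_nonneg hp.le ENNReal.coe_ne_top
  -- If all levels from j on were too heavy, N of them would have total mass at least `2 * β * N` in
  -- units of `K ^ p`, whereas the harmonic bound is the logarithm of the number of elements, which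
  -- grows like `β * N`.
  have key : ∀ N : ℕ, 1 ≤ N → (N : ℝ) * (2 * β) ≤
      1 + (Real.log (j + N) + (Real.log A + β * (j + N))) := by
    intro N hN
    set F := (Finset.Ico j (j + N)).biUnion E with hF
    have hFcard : (F.card : ℝ) ≤ (j + N) * (A * Real.exp (β * (j + N))) := by
      calc (F.card : ℝ) ≤ ∑ n ∈ Finset.Ico j (j + N), ((E n).card : ℝ) := by
            exact_mod_cast Finset.card_biUnion_le
        _ ≤ ∑ n ∈ Finset.Ico j (j + N), A * Real.exp (β * (j + N)) := by
            refine Finset.sum_le_sum fun n hn => (hcard n (Finset.mem_Ico.1 hn).1).trans ?_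
            have : (n : ℝ) ≤ j + N := by exact_mod_cast (Finset.mem_Ico.1 hn).2.le
            gcongr
        _ = N * (A * Real.exp (β * (j + N))) := by simp
        _ ≤ _ := by gcongr; simp
    have hpos : (0 : ℝ) < j + N := by
      have : (1 : ℝ) ≤ N := by exact_mod_cast hN
      positivity
    have hlog : ((harmonic F.card : ℚ) : ℝ) ≤
        1 + (Real.log (j + N) + (Real.log A + β * (j + N))) := by
      rcases Nat.eq_zero_or_pos F.card with h0 | h0
      · exfalso
        have h1 := hcon j le_rfl
        have h2 : E j = ∅ := by
          have : E j ⊆ F := Finset.subset_biUnion_of_mem E (Finset.mem_Ico.2 ⟨le_rfl, by omega⟩)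
          rw [Finset.card_eq_zero.1 h0] at this
          exact Finset.subset_empty.1 this
        rw [h2, Finset.sum_empty] at h1
        exact not_lt_zero h1
      · have h1 := harmonic_le_one_add_log F.card
        have h2 : Real.log F.card ≤ Real.log ((j + N) * (A * Real.exp (β * (j + N)))) :=
          Real.log_le_log (by exact_mod_cast h0) hFcard
        rw [Real.log_mul hpos.ne' (by positivity), Real.log_mul hA.ne' (Real.exp_pos _).ne',
          Real.log_exp] at h2
        linarith
    have hsum : (K : ℝ≥0∞) ^ p * ENNReal.ofReal (N * (2 * β)) ≤
        (K : ℝ≥0∞) ^ p * ENNReal.ofReal ((harmonic F.card : ℚ) : ℝ) := by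
      calc (K : ℝ≥0∞) ^ p * ENNReal.ofReal (N * (2 * β))
          = ∑ n ∈ Finset.Ico j (j + N), ENNReal.ofReal (2 * β) * (K : ℝ≥0∞) ^ p := by
            rw [ENNReal.ofReal_mul (by positivity), ENNReal.ofReal_natCast]
            simp; ring
        _ ≤ ∑ n ∈ Finset.Ico j (j + N), ∑ e ∈ E n, f e ^ p :=
            Finset.sum_le_sum fun n hn => (hcon n (Finset.mem_Ico.1 hn).1).le
        _ = ∑ e ∈ F, f e ^ p := by
            rw [hF, Finset.sum_biUnion fun m _ n _ hmn => hE hmn]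
        _ ≤ _ := h.sum_rpow_le_harmonic hp F
    rw [ENNReal.mul_le_mul_iff_right hKp0 hKp] at hsum
    have hN' : (0 : ℝ) < N := by exact_mod_cast hN
    exact (ENNReal.ofReal_le_ofReal_iff' .. |>.1 hsum).elim (fun h => h.trans hlog)
      fun h => absurd h (not_le.2 (by positivity))
  -- The remaining logarithm is bounded by a line of slope `β / 2`, so the right side of `key` grows
  -- at rate `3 * β / 2 < 2 * β`.
  obtain ⟨N, hN⟩ := exists_nat_gt
    ((1 + (β / 2 * j - 1 - Real.log (β / 2)) + Real.log A + β * j) / (β / 2))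
  have h1 := key (N + 1) (by omega)
  push_cast at h1
  have hpos : (0 : ℝ) < j + (N + 1) := by positivity
  have h2 := Real.log_le_sub_one_of_pos (show 0 < β / 2 * (j + (N + 1)) by positivity)
  rw [Real.log_mul (by positivity) hpos.ne'] at h2
  rw [div_lt_iff₀ (by positivity)] at hN
  nlinarith

end WeakBound

theorem WeakBound.card_le {X : Type*} {p : ℝ} {f : X → ℝ≥0∞} {K : ℝ≥0} (h : WeakBound p f K)
    (hp : 0 < p) {t : ℝ} (ht : 0 < t) {F : Finset X} (hF : ∀ x ∈ F, ENNReal.ofReal t < f x) :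
    (F.card : ℝ) ≤ (K : ℝ) ^ p / t ^ p := by
  have h1 : (F.card : ℝ≥0∞) ≤ (K : ℝ≥0∞) ^ p / ENNReal.ofReal t ^ p := by
    refine le_trans ?_ (h t.toNNReal (by simpa using ht))
    have h2 : ((F : Set X).encard : ℕ∞) ≤ {x | ((t.toNNReal : ℝ≥0) : ℝ≥0∞) < f x}.encard :=
      Set.encard_le_encard fun x hx => hF x hx
    rw [Set.encard_coe_eq_coe_finsetCard] at h2
    exact_mod_cast ENat.toENNReal_le.2 h2
  rw [← ENNReal.ofReal_coe_nnreal, ENNReal.ofReal_rpow_of_nonneg K.coe_nonneg hp.le,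
    ENNReal.ofReal_rpow_of_nonneg ht.le hp.le, ← ENNReal.ofReal_div_of_pos (by positivity),
    ← ENNReal.ofReal_natCast] at h1
  exact (ENNReal.ofReal_le_ofReal_iff (by positivity)).1 h1

/-! ### Descending rays and their weight -/

namespace HyperbolicFilling

variable {Z : Type*} [MetricSpace Z] {s R : ℝ} (X : HyperbolicFilling Z s R)

include X in
theorem scale_pos (n : ℕ) : 0 < R / s ^ n :=
  div_pos (Metric.diam_nonneg.trans_lt X.diam_lt) (pow_pos (one_pos.trans X.one_lt) n)

include X in
theorem tendsto_scale : Tendsto (fun n : ℕ => R / s ^ n) atTop (𝓝 0) :=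
  (tendsto_pow_atTop_atTop_of_one_lt X.one_lt).const_div_atTop R

theorem exists_center_dist_lt (n : ℕ) (z : Z) : ∃ p : X.centers n, dist z p < R / s ^ n := by
  by_contra! hcon
  have h1 : (insert z (X.centers n)).Pairwise fun p q => R / s ^ n ≤ dist p q :=
    (X.maximal n).1.insert fun p hp _ => ⟨hcon ⟨p, hp⟩, by rw [dist_comm]; exact hcon ⟨p, hp⟩⟩
  have h2 := (X.maximal n).2 h1 (subset_insert _ _) (mem_insert _ _)
  have h3 := hcon ⟨z, h2⟩
  rw [dist_self] at h3
  exact absurd h3 (not_le.2 (X.scale_pos n))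

/-- A vertex of level `n` whose center is at distance less than `R / s ^ n` from `z`. -/
def near (n : ℕ) (z : Z) : X.Vertex := ⟨n, (X.exists_center_dist_lt n z).choose⟩

@[simp]
theorem level_near (n : ℕ) (z : Z) : level (X.near n z) = n := rfl

theorem dist_center_near (n : ℕ) (z : Z) : dist z (center (X.near n z)) < R / s ^ n :=
  (X.exists_center_dist_lt n z).choose_spec

theorem mem_ball_near (n : ℕ) (z : Z) : z ∈ ball (X.near n z) := by
  have h1 := X.dist_center_near n z
  have h2 := X.scale_pos n
  rw [ball, Metric.mem_ball, radius, level_near]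
  linarith

variable {X}

theorem adj_of_mem_ball {v w : X.Vertex} (hvw : v ≠ w)
    (hl : |(level v : ℤ) - (level w : ℤ)| ≤ 1) {z : Z} (hv : z ∈ ball v) (hw : z ∈ ball w) :
    X.graph.Adj v w :=
  ⟨hvw, hl, z, subset_closure hv, subset_closure hw⟩

variable (X)

theorem adj_near_succ (n : ℕ) (z : Z) : X.graph.Adj (X.near n z) (X.near (n + 1) z) := by
  refine adj_of_mem_ball (fun h => ?_) ?_ (X.mem_ball_near n z) (X.mem_ball_near (n + 1) z)
  · simpa using congrArg level h
  · simp

/-- The edge of level `n` in the descending path to `z`. -/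
def rayEdge (n : ℕ) (z : Z) : X.graph.edgeSet :=
  ⟨s(X.near n z, X.near (n + 1) z), X.adj_near_succ n z⟩

variable {X}

/-- The levels n and n + 1 orient a ray edge: a match with the endpoints swapped would require `m =
n + 1` and `m + 1 = n`. -/
theorem rayEdge_eq_rayEdge {m n : ℕ} {z w : Z} (h : X.rayEdge m z = X.rayEdge n w) :
    m = n ∧ X.near m z = X.near n w := by
  have h1 : s(X.near m z, X.near (m + 1) z) = s(X.near n w, X.near (n + 1) w) :=
    congrArg Subtype.val h
  rcases Sym2.eq_iff.1 h1 with ⟨h2, -⟩ | ⟨h2, h3⟩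
  · exact ⟨by simpa using congrArg level h2, h2⟩
  · have h4 := congrArg level h2
    have h5 := congrArg level h3
    simp only [level_near] at h4 h5
    omega

theorem dist_lt_of_rayEdge_eq {n : ℕ} {z w : Z} (h : X.rayEdge n z = X.rayEdge n w) :
    dist z w < 2 * (R / s ^ n) := by
  have h1 := X.dist_center_near n z
  have h2 := X.dist_center_near n w
  rw [← (rayEdge_eq_rayEdge h).2] at h2
  linarith [dist_triangle_right z w (center (X.near n z))]

/-- An edge can be a ray edge at one level only, so a finite set of edges affects finitely many
levels. -/
theorem exists_rayEdge_notMem {B : Set X.graph.edgeSet} (hB : B.Finite) :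
    ∃ N, ∀ n, N ≤ n → ∀ z, X.rayEdge n z ∉ B := by
  have hfin : {n | ∃ z, X.rayEdge n z ∈ B}.Finite := by
    refine (hB.biUnion (t := fun e => {n | ∃ z, X.rayEdge n z = e}) fun e _ => ?_).subset ?_
    · refine Set.Subsingleton.finite ?_
      rintro m ⟨z, hz⟩ n ⟨w, hw⟩
      exact (rayEdge_eq_rayEdge (hz.trans hw.symm)).1
    · rintro n ⟨z, hz⟩
      exact mem_biUnion hz ⟨z, rfl⟩
  obtain ⟨N, hN⟩ := hfin.bddAbove
  exact ⟨N + 1, fun n hn z hz => absurd (hN ⟨z, hz⟩) (by omega)⟩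

/-- The radii of the points whose descending path passes through a given finite set of edges of
level `n` form a set of small measure. -/
theorem volume_rayEdge_mem_le (A : Set Z) (a : Z) (n : ℕ) (F : Finset X.graph.edgeSet) :
    volume {t : ℝ | ∃ z ∈ A, dist a z = t ∧ X.rayEdge n z ∈ F} ≤
      ENNReal.ofReal (F.card * (2 * (R / s ^ n))) := by
  have hsub : {t : ℝ | ∃ z ∈ A, dist a z = t ∧ X.rayEdge n z ∈ F} ⊆
      ⋃ e ∈ F, {t : ℝ | ∃ z, dist a z = t ∧ X.rayEdge n z = e} := by
    rintro t ⟨z, -, hz, he⟩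
    exact mem_biUnion he ⟨z, hz, rfl⟩
  calc _ ≤ volume (⋃ e ∈ F, {t : ℝ | ∃ z, dist a z = t ∧ X.rayEdge n z = e}) := measure_mono hsub
    _ ≤ ∑ e ∈ F, volume {t : ℝ | ∃ z, dist a z = t ∧ X.rayEdge n z = e} :=
        measure_biUnion_finset_le _ _
    _ ≤ ∑ _e ∈ F, ENNReal.ofReal (2 * (R / s ^ n)) := by
        refine Finset.sum_le_sum fun e _ => (Real.volume_le_diam _).trans ?_
        refine Metric.ediam_le ?_
        rintro _ ⟨z, rfl, hz⟩ _ ⟨w, rfl, hw⟩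
        rw [edist_dist]
        refine ENNReal.ofReal_le_ofReal ?_
        have h1 := dist_lt_of_rayEdge_eq (hz.trans hw.symm)
        have h2 := dist_triangle a z w
        have h3 := dist_triangle a w z
        rw [dist_comm w z] at h3
        rw [Real.dist_eq, abs_le]
        constructor <;> linarith
    _ = _ := by
        rw [Finset.sum_const, nsmul_eq_mul, ENNReal.ofReal_mul (Nat.cast_nonneg F.card),
          ENNReal.ofReal_natCast]

/-- If the distances to `a` of the points of `A` fill `[0, R / s ^ n)` and `n` is large, then some
point of `A` close to `a` has a descending path from level `n` of small total weight. -/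
theorem exists_tsum_rayEdge_le {Q : ℝ} (hQ : 0 < Q) {τ : X.graph.edgeSet → ℝ≥0∞} {K : ℝ≥0}
    (h : WeakBound Q τ K) :
    ∃ N, ∀ n, N ≤ n → ∀ (A : Set Z) (a : Z),
      (∀ t ∈ Ico 0 (R / s ^ n), ∃ z ∈ A, dist a z = t) →
        ∃ z ∈ A, dist a z < R / s ^ n ∧
          ∑' k, τ (X.rayEdge (n + k) z) ≤ ENNReal.ofReal (1 / 4) := by
  have hs0 : 0 < s := one_pos.trans X.one_lt
  -- The thresholds `η * x ^ k` sum to 1/4. At most a multiple of `q ^ (-k)` edges exceed the k-th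
  -- one, and each spoils radii of measure at most a multiple of `s ^ (-k) = q ^ (2 * k)`, so the
  -- spoiled measure decays like `q ^ k`.
  set q : ℝ := (√s)⁻¹ with hq
  have hsq : 1 < √s := Real.lt_sqrt_of_sq_lt (by simpa using X.one_lt)
  have hq0 : 0 < q := inv_pos.2 (by linarith)
  have hq1 : q < 1 := inv_lt_one_of_one_lt₀ hsq
  have hqs : ∀ k : ℕ, (s ^ k)⁻¹ = q ^ k * q ^ k := fun k => by
    rw [hq, ← mul_pow, ← mul_inv, Real.mul_self_sqrt hs0.le, inv_pow]
  set x : ℝ := q ^ Q⁻¹ with hx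
  have hx0 : 0 < x := Real.rpow_pos_of_pos hq0 _
  have hx1 : x < 1 := Real.rpow_lt_one hq0.le hq1 (inv_pos.2 hQ)
  have hxQ : ∀ k : ℕ, (x ^ k) ^ Q = q ^ k := fun k => by
    rw [← Real.rpow_natCast, ← Real.rpow_mul hx0.le, mul_comm, Real.rpow_mul hx0.le,
      hx, Real.rpow_inv_rpow hq0.le hQ.ne', Real.rpow_natCast]
  set η : ℝ := (1 - x) / 4 with hη
  have hη0 : 0 < η := by rw [hη]; linarith
  set D : ℝ := 2 * ((K : ℝ) ^ Q / η ^ Q) with hD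
  have hD0 : 0 ≤ D := by positivity
  -- From index m on, the spoiled radii cannot fill `[0, R / s ^ n)`. Smaller indices are handled by
  -- N: beyond it no ray edge exceeds even the m-th threshold.
  obtain ⟨m, hm⟩ : ∃ m : ℕ, D / (1 - q) * q ^ m < 1 := by
    have := (tendsto_pow_atTop_nhds_zero_of_lt_one hq0.le hq1).const_mul (D / (1 - q))
    rw [mul_zero] at this
    exact (this.eventually_lt_const one_pos).exists
  have hfin : ∀ k : ℕ, {e | ENNReal.ofReal (η * x ^ k) < τ e}.Finite := fun k =>
    h.finite hQ (t := (η * x ^ k).toNNReal) (Real.toNNReal_pos.2 (by positivity))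
  obtain ⟨N, hN⟩ := exists_rayEdge_notMem (hfin m)
  refine ⟨N, fun n hn A a hA => ?_⟩
  have hr := X.scale_pos n
  by_contra! hcon
  let T : ℕ → Set ℝ := fun i => {t : ℝ | ∃ z ∈ A, dist a z = t ∧
    X.rayEdge (n + (m + i)) z ∈ (hfin (m + i)).toFinset}
  have hcover : Ico 0 (R / s ^ n) ⊆ ⋃ i, T i := by
    intro t ht
    obtain ⟨z, hzA, hz⟩ := hA t ht
    have h1 := hcon z hzA (hz ▸ ht.2)
    obtain ⟨k, hk⟩ : ∃ k, ENNReal.ofReal (η * x ^ k) < τ (X.rayEdge (n + k) z) := by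
      by_contra! hle
      refine absurd ((ENNReal.tsum_le_tsum hle).trans_eq ?_) (not_le.2 h1)
      rw [← ENNReal.ofReal_tsum_of_nonneg (fun k => by positivity)
        ((summable_geometric_of_lt_one hx0.le hx1).mul_left _), tsum_mul_left,
        tsum_geometric_of_lt_one hx0.le hx1]
      congr 1
      rw [hη]
      have : 1 - x ≠ 0 := by linarith
      field_simp
    have hmk : m ≤ k := by
      by_contra! hkm
      refine hN (n + k) (by omega) z (lt_of_le_of_lt (ENNReal.ofReal_le_ofReal ?_) hk)
      have := pow_le_pow_of_le_one hx0.le hx1.le hkm.le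
      gcongr
    obtain ⟨i, rfl⟩ := Nat.exists_eq_add_of_le hmk
    exact mem_iUnion.2 ⟨i, z, hzA, hz, by simpa using hk⟩
  have hT : ∀ i, volume (T i) ≤ ENNReal.ofReal (D * q ^ m * (R / s ^ n) * q ^ i) := by
    intro i
    refine (volume_rayEdge_mem_le A a _ _).trans (ENNReal.ofReal_le_ofReal ?_)
    have hc := h.card_le hQ (t := η * x ^ (m + i)) (by positivity) (F := (hfin (m + i)).toFinset)
      (fun e he => by simpa using he)
    rw [Real.mul_rpow hη0.le (by positivity), hxQ] at hc
    have hqm : 0 < q ^ (m + i) := by positivity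
    have e1 : R / s ^ (n + (m + i)) = R / s ^ n * (q ^ (m + i) * q ^ (m + i)) := by
      rw [pow_add s, ← hqs]; field_simp
    rw [e1]
    calc _ ≤ (K : ℝ) ^ Q / (η ^ Q * q ^ (m + i)) *
          (2 * (R / s ^ n * (q ^ (m + i) * q ^ (m + i)))) := by gcongr
      _ = _ := by
        rw [hD]
        have : η ^ Q ≠ 0 := by positivity
        field_simp
        ring
  have hvol : ENNReal.ofReal (R / s ^ n) ≤ ENNReal.ofReal (D * q ^ m * (R / s ^ n) / (1 - q)) := by
    calc ENNReal.ofReal (R / s ^ n) = volume (Ico 0 (R / s ^ n)) := by simp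
      _ ≤ volume (⋃ i, T i) := measure_mono hcover
      _ ≤ ∑' i, volume (T i) := measure_iUnion_le _
      _ ≤ ∑' i, ENNReal.ofReal (D * q ^ m * (R / s ^ n) * q ^ i) := ENNReal.tsum_le_tsum hT
      _ = _ := by
        rw [← ENNReal.ofReal_tsum_of_nonneg (fun k => by positivity)
          ((summable_geometric_of_lt_one hq0.le hq1).mul_left _), tsum_mul_left,
          tsum_geometric_of_lt_one hq0.le hq1]
        rfl
  have h1q : 0 < 1 - q := by linarith
  rw [ENNReal.ofReal_le_ofReal_iff (by positivity)] at hvol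
  have : D * q ^ m * (R / s ^ n) / (1 - q) = D / (1 - q) * q ^ m * (R / s ^ n) := by ring
  rw [this] at hvol
  nlinarith

end HyperbolicFilling

/-! ### Joining two rays by a walk along a connected set -/

theorem sum_range_getVert {V M : Type*} [AddCommMonoid M] {G : SimpleGraph V} (f : Sym2 V → M)
    {u v : V} (p : G.Walk u v) :
    ∑ i ∈ Finset.range p.length, f s(p.getVert i, p.getVert (i + 1)) = (p.edges.map f).sum := by
  induction p with
  | nil => simp
  | cons h p ih =>
    simp only [SimpleGraph.Walk.length_cons, SimpleGraph.Walk.edges_cons, List.map_cons,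
      List.sum_cons, Finset.sum_range_succ', SimpleGraph.Walk.getVert_cons_succ, ih,
      SimpleGraph.Walk.getVert_zero]
    rw [add_comm]

namespace HyperbolicFilling

variable {Z : Type*} [MetricSpace Z] {s R : ℝ} {X : HyperbolicFilling Z s R}

theorem radius_pos (v : X.Vertex) : 0 < radius v :=
  mul_pos two_pos (X.scale_pos _)

/-- Finitely many initial terms only enlarge the nontangential constant, here by the sum of their
ratios. -/
theorem ConvergesNontangentially.of_add {v : ℕ → X.Vertex} {z : Z} (L : ℕ)
    (h : ConvergesNontangentially (fun n => v (n + L)) z) : ConvergesNontangentially v z := by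
  obtain ⟨h1, h2, C, hC, h3⟩ := h
  refine ⟨(tendsto_add_atTop_iff_nat L).1 h1, (tendsto_add_atTop_iff_nat L).1 h2,
    C + ∑ i ∈ Finset.range L, dist z (center (v i)) / radius (v i), ?_, fun n => ?_⟩
  · have : 0 ≤ ∑ i ∈ Finset.range L, dist z (center (v i)) / radius (v i) :=
      Finset.sum_nonneg fun i _ => div_nonneg dist_nonneg (radius_pos _).le
    linarith
  · rcases lt_or_ge n L with hn | hn
    · have h4 : dist z (center (v n)) / radius (v n) ≤
          ∑ i ∈ Finset.range L, dist z (center (v i)) / radius (v i) :=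
        Finset.single_le_sum (f := fun i => dist z (center (v i)) / radius (v i))
          (fun i _ => div_nonneg dist_nonneg (radius_pos _).le) (Finset.mem_range.2 hn)
      rw [← div_le_iff₀ (radius_pos _)]
      linarith
    · obtain ⟨k, rfl⟩ := Nat.exists_eq_add_of_le' hn
      refine (h3 k).trans ?_
      gcongr
      · exact (radius_pos _).le
      · exact le_add_of_nonneg_right
          (Finset.sum_nonneg fun i _ => div_nonneg dist_nonneg (radius_pos _).le)

theorem convergesNontangentially_near (n : ℕ) (z : Z) :
    ConvergesNontangentially (fun k => X.near (n + k) z) z := by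
  have h0 : Tendsto (fun k : ℕ => R / s ^ (n + k)) atTop (𝓝 0) := by
    have := (tendsto_add_atTop_iff_nat n).2 X.tendsto_scale
    simpa only [add_comm] using this
  refine ⟨?_, ?_, 1, one_pos, fun k => ?_⟩
  · rw [tendsto_iff_dist_tendsto_zero]
    refine squeeze_zero (fun _ => dist_nonneg) (fun k => ?_) h0
    rw [dist_comm]
    exact (X.dist_center_near (n + k) z).le
  · simpa [radius] using h0.const_mul 2
  · have h1 := X.dist_center_near (n + k) z
    have h2 := X.scale_pos (n + k)
    rw [radius, level_near]
    linarith

namespace InfinitePath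

variable {u v : ℕ → X.Vertex}

/-- The vertices of the infinite path that runs along `u` from infinity, then along `p`, then
along `v` to infinity. -/
def joinVert (u v : ℕ → X.Vertex) (p : X.graph.Walk (u 0) (v 0)) : ℤ → X.Vertex
  | Int.ofNat i => if i < p.length then p.getVert i else v (i - p.length)
  | Int.negSucc i => u (i + 1)

theorem joinVert_add_length (p : X.graph.Walk (u 0) (v 0)) (i : ℕ) :
    joinVert u v p ((i + p.length : ℕ) : ℤ) = v i := by
  change (if i + p.length < p.length then p.getVert (i + p.length)
    else v (i + p.length - p.length)) = v i
  simp

theorem joinVert_of_le (p : X.graph.Walk (u 0) (v 0)) {i : ℕ} (hi : i ≤ p.length) :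
    joinVert u v p (i : ℤ) = p.getVert i := by
  change (if i < p.length then p.getVert i else v (i - p.length)) = p.getVert i
  rcases hi.lt_or_eq with h | h
  · rw [if_pos h]
  · simp [h]

theorem joinVert_neg (p : X.graph.Walk (u 0) (v 0)) (i : ℕ) :
    joinVert u v p (-(i : ℤ)) = u i := by
  cases i with
  | zero => simpa using joinVert_of_le p (Nat.zero_le _)
  | succ i => rfl

/-- The infinite path formed by two rays and a walk. -/
def join (hu : ∀ k, X.graph.Adj (u k) (u (k + 1))) (hv : ∀ k, X.graph.Adj (v k) (v (k + 1)))
    (p : X.graph.Walk (u 0) (v 0)) : X.InfinitePath where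
  vert := joinVert u v p
  adj n := by
    rcases n with i | i
    · rcases lt_or_ge i p.length with h | h
      · rw [Int.ofNat_eq_natCast, ← Nat.cast_succ, joinVert_of_le p h.le, joinVert_of_le p h]
        exact p.adj_getVert_succ h
      · obtain ⟨k, rfl⟩ := Nat.exists_eq_add_of_le' h
        rw [Int.ofNat_eq_natCast, ← Nat.cast_succ, joinVert_add_length,
          show (k + p.length).succ = (k + 1) + p.length by omega, joinVert_add_length]
        exact hv k
    · have h1 : Int.negSucc i = -((i + 1 : ℕ) : ℤ) := rfl
      have h2 : Int.negSucc i + 1 = -(i : ℤ) := by rw [h1]; push_cast; ring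
      rw [h2, h1, joinVert_neg, joinVert_neg]
      exact (hu i).symm

variable (hu : ∀ k, X.graph.Adj (u k) (u (k + 1))) (hv : ∀ k, X.graph.Adj (v k) (v (k + 1)))
  (p : X.graph.Walk (u 0) (v 0))

theorem connects_join {A B : Set Z} {z w : Z} (hz : z ∈ A) (hw : w ∈ B)
    (huz : ConvergesNontangentially u z) (hvw : ConvergesNontangentially v w) :
    (join hu hv p).Connects A B := by
  refine ⟨⟨z, hz, ?_⟩, w, hw, .of_add p.length ?_⟩
  · simpa only [join, joinVert_neg] using huz
  · simpa only [join, joinVert_add_length] using hvw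

theorem tsum_join (f : Sym2 X.Vertex → ℝ≥0∞) :
    ∑' n : ℤ, f ((join hu hv p).edge n) =
      (p.edges.map f).sum + ∑' k, f s(v k, v (k + 1)) + ∑' k, f s(u k, u (k + 1)) := by
  set g : ℤ → ℝ≥0∞ := fun n => f ((join hu hv p).edge n) with hg
  have hgn : ∀ n, g n = f s(joinVert u v p n, joinVert u v p (n + 1)) := fun n => rfl
  have h1 : ∑' n : ℤ, g n = ∑' n : ℕ, g n + ∑' n : ℕ, g (-(n + 1)) :=
    (HasSum.of_nat_of_neg_add_one ENNReal.summable.hasSum ENNReal.summable.hasSum).tsum_eq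
  have h2 : ∑' n : ℕ, g n = ∑ i ∈ Finset.range p.length, g i + ∑' i : ℕ, g ((i + p.length : ℕ)) :=
    (ENNReal.summable.sum_add_tsum_nat_add' (f := fun n : ℕ => g n) (k := p.length)).symm
  rw [h1, h2, ← sum_range_getVert]
  congr 1
  · congr 1
    · refine Finset.sum_congr rfl fun i hi => ?_
      have hi := Finset.mem_range.1 hi
      rw [hgn, ← Nat.cast_succ, joinVert_of_le p hi.le, joinVert_of_le p hi]
    · refine tsum_congr fun i => ?_
      rw [hgn, ← Nat.cast_succ, joinVert_add_length,
        show (i + p.length).succ = (i + 1) + p.length by omega, joinVert_add_length]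
  · refine tsum_congr fun i => ?_
    rw [hgn, show -((i : ℤ) + 1) + 1 = -(i : ℤ) by ring, joinVert_neg, ← Nat.cast_succ, joinVert_neg, Sym2.eq_swap]

end InfinitePath

variable (X)

/-- The vertices of level `n` whose balls meet `Γ`. -/
def trace (Γ : Set Z) (n : ℕ) : Set X.Vertex := {v | level v = n ∧ (ball v ∩ Γ).Nonempty}

variable {X}

/-- The vertices of a fixed level that meet a connected set can be joined by paths consisting of
such vertices. -/
theorem exists_walk_trace {Γ : Set Z} (hΓ : IsPreconnected Γ) {n : ℕ} {u v : X.Vertex}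
    (hu : u ∈ X.trace Γ n) (hv : v ∈ X.trace Γ n) :
    ∃ p : X.graph.Walk u v, p.edges.Nodup ∧ ∀ e ∈ p.edges, ∀ x ∈ e, x ∈ X.trace Γ n := by
  classical
  let H : SimpleGraph X.Vertex :=
    { Adj := fun v w => X.graph.Adj v w ∧ v ∈ X.trace Γ n ∧ w ∈ X.trace Γ n
      symm := ⟨fun _ _ h => ⟨h.1.symm, h.2.2, h.2.1⟩⟩
      loopless := ⟨fun _ h => h.1.ne rfl⟩ }
  have hreach : H.Reachable u v := by
    by_contra hnot
    -- If v were unreachable, `O₁` and `O₂` would be open sets covering Γ, both meeting it.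
    -- Connectedness gives a common point, hence an edge between the two classes.
    let O₁ : Set Z := ⋃ x ∈ {x | x ∈ X.trace Γ n ∧ H.Reachable u x}, ball x
    let O₂ : Set Z := ⋃ x ∈ {x | x ∈ X.trace Γ n ∧ ¬ H.Reachable u x}, ball x
    have hO₁ : IsOpen O₁ := isOpen_biUnion fun _ _ => Metric.isOpen_ball
    have hO₂ : IsOpen O₂ := isOpen_biUnion fun _ _ => Metric.isOpen_ball
    have hcover : Γ ⊆ O₁ ∪ O₂ := by
      intro z hz
      have hmem : X.near n z ∈ X.trace Γ n := ⟨rfl, z, X.mem_ball_near n z, hz⟩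
      by_cases h : H.Reachable u (X.near n z)
      · exact Or.inl (mem_biUnion (show _ ∧ _ from ⟨hmem, h⟩) (X.mem_ball_near n z))
      · exact Or.inr (mem_biUnion (show _ ∧ _ from ⟨hmem, h⟩) (X.mem_ball_near n z))
    obtain ⟨z₁, hz₁, hz₁'⟩ := hu.2
    obtain ⟨z₂, hz₂, hz₂'⟩ := hv.2
    obtain ⟨z, hz, h1, h2⟩ := hΓ O₁ O₂ hO₁ hO₂ hcover
      ⟨z₁, hz₁', mem_biUnion (show _ ∧ _ from ⟨hu, .refl u⟩) hz₁⟩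
      ⟨z₂, hz₂', mem_biUnion (show _ ∧ _ from ⟨hv, hnot⟩) hz₂⟩
    obtain ⟨x, ⟨hx, hux⟩, hzx⟩ := mem_iUnion₂.1 h1
    obtain ⟨y, ⟨hy, huy⟩, hzy⟩ := mem_iUnion₂.1 h2
    have hxy : x ≠ y := by rintro rfl; exact huy hux
    have hadj : H.Adj x y :=
      ⟨adj_of_mem_ball hxy (by simp [hx.1, hy.1]) hzx hzy, hx, hy⟩
    exact huy (hux.trans hadj.reachable)
  obtain ⟨w⟩ := hreach
  have hle : H ≤ X.graph := fun _ _ h => h.1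
  -- Passing to a path makes the edges distinct, so that their mass can be bounded by a sum over a
  -- finite set.
  refine ⟨(w.toPath : H.Walk u v).mapLe hle, ?_, fun e he x hx => ?_⟩
  · rw [SimpleGraph.Walk.edges_mapLe_eq_edges]
    exact w.toPath.2.isTrail.edges_nodup
  · rw [SimpleGraph.Walk.edges_mapLe_eq_edges] at he
    have he' := SimpleGraph.Walk.edges_subset_edgeSet _ he
    induction e using Sym2.ind with
    | _ y z =>
      have hyz : H.Adj y z := he'
      rcases Sym2.mem_iff.1 hx with rfl | rfl
      exacts [hyz.2.1, hyz.2.2]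

/-- If two points of `A` and `B` have descending paths of small weight from level `n`, and these
start next to a connected set `Γ`, then the edges of level `n` along `Γ` carry a definite part of
the mass of an admissible function. -/
theorem Admissible.half_le_sum {A B : Set Z} {τ : X.graph.edgeSet → ℝ≥0∞}
    (hτ : X.Admissible A B τ) {Γ : Set Z} (hΓ : IsPreconnected Γ) {n : ℕ} {z w : Z}
    (hz : z ∈ A) (hw : w ∈ B) (hzΓ : X.near n z ∈ X.trace Γ n) (hwΓ : X.near n w ∈ X.trace Γ n)
    (hzsum : ∑' k, τ (X.rayEdge (n + k) z) ≤ ENNReal.ofReal (1 / 4))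
    (hwsum : ∑' k, τ (X.rayEdge (n + k) w) ≤ ENNReal.ofReal (1 / 4))
    {F : Finset X.graph.edgeSet}
    (hF : ∀ e : X.graph.edgeSet, (∀ x ∈ e.1, x ∈ X.trace Γ n) → e ∈ F) :
    ENNReal.ofReal (1 / 2) ≤ ∑ e ∈ F, τ e := by
  classical
  obtain ⟨p, hp, hpΓ⟩ := exists_walk_trace hΓ hzΓ hwΓ
  -- The edges of a walk are listed in `Sym2`, so τ is extended by zero.
  let f : Sym2 X.Vertex → ℝ≥0∞ := Function.extend Subtype.val τ 0
  have hf : ∀ e : X.graph.edgeSet, f e = τ e := fun e =>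
    Subtype.val_injective.extend_apply τ 0 e
  have hu : ∀ k, X.graph.Adj (X.near (n + k) z) (X.near (n + (k + 1)) z) := fun k =>
    X.adj_near_succ (n + k) z
  have hv : ∀ k, X.graph.Adj (X.near (n + k) w) (X.near (n + (k + 1)) w) := fun k =>
    X.adj_near_succ (n + k) w
  have h1 := hτ _ (InfinitePath.connects_join (u := fun k => X.near (n + k) z)
    (v := fun k => X.near (n + k) w) hu hv p hz hw
    (convergesNontangentially_near n z) (convergesNontangentially_near n w))
  simp only [← hf] at h1
  rw [InfinitePath.tsum_join] at h1
  have hpsum : (p.edges.map f).sum ≤ ∑ e ∈ F, τ e := by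
    rw [← List.sum_toFinset f hp]
    calc ∑ e ∈ p.edges.toFinset, f e
        ≤ ∑ e ∈ F.map (Function.Embedding.subtype _), f e := by
          refine Finset.sum_le_sum_of_subset fun e he => ?_
          rw [List.mem_toFinset] at he
          have he' := p.edges_subset_edgeSet he
          exact Finset.mem_map.2 ⟨⟨e, he'⟩, hF ⟨e, he'⟩ (hpΓ e he), rfl⟩
      _ = _ := by simp [hf]
  have hzsum' : ∑' k, f s(X.near (n + k) z, X.near (n + (k + 1)) z) ≤ ENNReal.ofReal (1 / 4) :=
    (tsum_congr fun k => hf (X.rayEdge (n + k) z)).trans_le hzsum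
  have hwsum' : ∑' k, f s(X.near (n + k) w, X.near (n + (k + 1)) w) ≤ ENNReal.ofReal (1 / 4) :=
    (tsum_congr fun k => hf (X.rayEdge (n + k) w)).trans_le hwsum
  have h2 : ENNReal.ofReal (1 / 2) + ENNReal.ofReal (1 / 2) ≤
      ∑ e ∈ F, τ e + ENNReal.ofReal (1 / 2) := by
    calc ENNReal.ofReal (1 / 2) + ENNReal.ofReal (1 / 2) = 1 := by
          rw [← ENNReal.ofReal_add (by norm_num) (by norm_num)]; norm_num
      _ ≤ _ := h1
      _ ≤ ∑ e ∈ F, τ e + ENNReal.ofReal (1 / 4) + ENNReal.ofReal (1 / 4) := by gcongr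
      _ = _ := by
          rw [add_assoc, ← ENNReal.ofReal_add (by norm_num) (by norm_num)]; norm_num
  exact ENNReal.le_of_add_le_add_right ENNReal.ofReal_ne_top h2

end HyperbolicFilling

/-! ### Counting vertices and edges of a level -/

namespace HyperbolicFilling

variable {Z : Type*} [MetricSpace Z] {s R : ℝ} (X : HyperbolicFilling Z s R)

theorem finite_centers [CompactSpace Z] (n : ℕ) : (X.centers n).Finite := by
  have hr := X.scale_pos n
  obtain ⟨t, -, ht, hcover⟩ := finite_cover_balls_of_compact (isCompact_univ (X := Z)) (half_pos hr)
  refine (ht.biUnion (t := fun x => X.centers n ∩ Metric.ball x (R / s ^ n / 2))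
    fun x _ => Set.Subsingleton.finite ?_).subset fun p hp => ?_
  · rintro p ⟨hp, hpx⟩ q ⟨hq, hqx⟩
    by_contra hpq
    have h1 := (X.maximal n).1 hp hq hpq
    rw [Metric.mem_ball] at hpx hqx
    linarith [dist_triangle_right p q x]
  · obtain ⟨x, hx, hpx⟩ := mem_iUnion₂.1 (hcover (mem_univ p))
    exact mem_biUnion hx ⟨hp, hpx⟩

theorem ext_vertex {v w : X.Vertex} (h : level v = level w) (h' : center v = center w) :
    v = w := by
  obtain ⟨k, p⟩ := v
  obtain ⟨l, q⟩ := w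
  obtain rfl : k = l := h
  obtain rfl : p = q := Subtype.ext h'
  rfl

/-- The edges between vertices of level `n`. -/
def levelEdges (n : ℕ) : Set X.graph.edgeSet := {e | ∀ v ∈ e.1, level v = n}

variable {X}

/-- The centers of the endpoints of an edge. -/
def endCenters (e : X.graph.edgeSet) : Z × Z := (center e.1.out.1, center e.1.out.2)

theorem injOn_endCenters (n : ℕ) : InjOn endCenters (X.levelEdges n) := by
  intro e he f hf hef
  have h1 : e.1.out = f.1.out := by
    refine Prod.ext (X.ext_vertex ?_ (congrArg Prod.fst hef))
      (X.ext_vertex ?_ (congrArg Prod.snd hef))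
    · rw [he _ (Sym2.out_fst_mem _), hf _ (Sym2.out_fst_mem _)]
    · rw [he _ (Sym2.out_snd_mem _), hf _ (Sym2.out_snd_mem _)]
  refine Subtype.ext ?_
  rw [← Quot.out_eq e.1, ← Quot.out_eq f.1]
  exact congrArg _ h1

theorem center_mem_centers {v : X.Vertex} {n : ℕ} (h : level v = n) : center v ∈ X.centers n := by
  subst h; exact v.2.2

theorem endCenters_mem {n : ℕ} {e : X.graph.edgeSet} (he : e ∈ X.levelEdges n) :
    (endCenters e).1 ∈ X.centers n ∧ (endCenters e).2 ∈ X.centers n :=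
  ⟨center_mem_centers (he _ (Sym2.out_fst_mem _)), center_mem_centers (he _ (Sym2.out_snd_mem _))⟩

theorem dist_center_le_of_adj {v w : X.Vertex} (h : X.graph.Adj v w) :
    dist (center v) (center w) ≤ radius v + radius w := by
  obtain ⟨z, hv, hw⟩ := h.2.2
  have h1 := Metric.mem_closedBall.1 (Metric.closure_ball_subset_closedBall hv)
  have h2 := Metric.mem_closedBall.1 (Metric.closure_ball_subset_closedBall hw)
  linarith [dist_triangle_left (center v) (center w) z]

theorem dist_endCenters_le {n : ℕ} {e : X.graph.edgeSet} (he : e ∈ X.levelEdges n) :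
    dist (endCenters e).1 (endCenters e).2 ≤ 4 * (R / s ^ n) := by
  have hadj : X.graph.Adj e.1.out.1 e.1.out.2 := by
    have h1 : s(e.1.out.1, e.1.out.2) = e.1 := Quot.out_eq e.1
    have h2 : s(e.1.out.1, e.1.out.2) ∈ X.graph.edgeSet := by rw [h1]; exact e.2
    exact h2
  have h := dist_center_le_of_adj hadj
  rw [radius, radius, he _ (Sym2.out_fst_mem _), he _ (Sym2.out_snd_mem _)] at h
  refine h.trans_eq ?_
  ring

/-- A crude count by pairs of centers; squaring affects only the constants. -/
theorem card_edges_le {n : ℕ} {F : Finset X.graph.edgeSet} (hF : ∀ e ∈ F, e ∈ X.levelEdges n)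
    {V : Finset Z} (hV : ∀ e ∈ F, (endCenters e).1 ∈ V ∧ (endCenters e).2 ∈ V) :
    F.card ≤ V.card ^ 2 := by
  classical
  rw [sq, ← Finset.card_product]
  refine Finset.card_le_card_of_injOn endCenters (fun e he => ?_)
    ((injOn_endCenters n).mono fun e he => hF e he)
  exact Finset.mem_product.2 (hV e he)

variable (X) in
theorem finite_levelEdges [CompactSpace Z] (n : ℕ) : (X.levelEdges n).Finite := by
  refine Set.Finite.of_injOn (t := X.centers n ×ˢ X.centers n) (fun e he => endCenters_mem he)
    (injOn_endCenters n) ((X.finite_centers n).prod (X.finite_centers n))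

section Measure

variable [MeasurableSpace Z] [BorelSpace Z] {μ : Measure Z} {Q c C : ℝ}

/-- Balls of half the separation are disjoint, and regularity bounds their measures below. -/
theorem card_centers_le (hμ : IsAhlforsRegular μ Q c C) {n : ℕ}
    (hn : R / s ^ n / 2 ≤ Metric.diam (univ : Set Z)) {V : Finset Z} (hV : ↑V ⊆ X.centers n)
    {W : Set Z} (hW : ∀ p ∈ V, Metric.ball p (R / s ^ n / 2) ⊆ W) :
    V.card * ENNReal.ofReal (c * (R / s ^ n / 2) ^ Q) ≤ μ W := by
  have hr := X.scale_pos n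
  calc (V.card : ℝ≥0∞) * ENNReal.ofReal (c * (R / s ^ n / 2) ^ Q)
      = ∑ _p ∈ V, ENNReal.ofReal (c * (R / s ^ n / 2) ^ Q) := by simp
    _ ≤ ∑ p ∈ V, μ (Metric.ball p (R / s ^ n / 2)) :=
        Finset.sum_le_sum fun p _ => (hμ p _ (half_pos hr) hn).1
    _ = μ (⋃ p ∈ V, Metric.ball p (R / s ^ n / 2)) := by
        refine (measure_biUnion_finset (fun p hp q hq hpq => ?_) fun p _ =>
          measurableSet_ball).symm
        refine Metric.ball_disjoint_ball ?_
        rw [add_halves]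
        exact (X.maximal n).1 (hV hp) (hV hq) hpq
    _ ≤ μ W := measure_mono (iUnion₂_subset hW)

/-- The 7 is 3 + 4: an endpoint lies within 3 scales of z and the other endpoint within 4 of it. The
16 is the ratio of the radii 8 and 1/2. -/
theorem card_centers_near_le (hμ : IsAhlforsRegular μ Q c C) (hc : 0 < c) (hC : 0 < C) {n : ℕ}
    (hn : 8 * (R / s ^ n) ≤ Metric.diam (univ : Set Z)) {V : Finset Z} (hV : ↑V ⊆ X.centers n)
    {z : Z} (hz : ∀ p ∈ V, dist p z ≤ 7 * (R / s ^ n)) : (V.card : ℝ) ≤ C / c * 16 ^ Q := by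
  have hr := X.scale_pos n
  have h1 := card_centers_le hμ (by linarith) hV (W := Metric.ball z (8 * (R / s ^ n)))
    fun p hp => Metric.ball_subset_ball' (by linarith [hz p hp])
  have h2 := h1.trans (hμ z _ (by linarith) hn).2
  rw [← ENNReal.ofReal_natCast, ← ENNReal.ofReal_mul (by positivity),
    ENNReal.ofReal_le_ofReal_iff (by positivity)] at h2
  have h3 : (8 * (R / s ^ n)) ^ Q = 16 ^ Q * (R / s ^ n / 2) ^ Q := by
    rw [← Real.mul_rpow (by norm_num) (by linarith)]; congr 1; ring
  have h4 : 0 < (R / s ^ n / 2) ^ Q := by positivity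
  rw [h3, ← mul_assoc, ← mul_assoc, mul_le_mul_iff_left₀ h4] at h2
  rw [div_mul_eq_mul_div, le_div_iff₀ hc]
  exact h2

theorem measure_univ_lt_top [CompactSpace Z] (hμ : IsAhlforsRegular μ Q c C)
    (hd : 0 < Metric.diam (univ : Set Z)) : μ univ < ∞ := by
  have : IsLocallyFiniteMeasure μ := ⟨fun z => ⟨Metric.ball z (Metric.diam (univ : Set Z)),
    Metric.ball_mem_nhds z hd, (hμ z _ hd le_rfl).2.trans_lt ENNReal.ofReal_lt_top⟩⟩
  exact isCompact_univ.measure_lt_top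

/-- The number of edges of level `n` grows at most exponentially. -/
theorem exists_card_levelEdges_le [CompactSpace Z] (hμ : IsAhlforsRegular μ Q c C) (hc : 0 < c)
    (hd : 0 < Metric.diam (univ : Set Z)) :
    ∃ A : ℝ, 0 < A ∧ ∀ n, R / s ^ n / 2 ≤ Metric.diam (univ : Set Z) →
      ((X.finite_levelEdges n).toFinset.card : ℝ) ≤ A * Real.exp (2 * Q * Real.log s * n) := by
  have hs : 0 < s := one_pos.trans X.one_lt
  have hR : 0 < R := Metric.diam_nonneg.trans_lt X.diam_lt
  have hfin := measure_univ_lt_top hμ hd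
  set m := (μ univ).toReal with hm
  have hm0 : 0 ≤ m := ENNReal.toReal_nonneg
  -- This prefactor depends on Z and R, but the final estimate uses only the exponential rate `2 * Q
  -- * Real.log s`.
  set B : ℝ := m / (c * (R / 2) ^ Q) with hB
  refine ⟨B ^ 2 + 1, by positivity, fun n hn => ?_⟩
  have hr := X.scale_pos n
  have h1 := card_centers_le (X := X) hμ hn (V := (X.finite_centers n).toFinset) (by simp)
    (W := univ) fun _ _ => subset_univ _
  rw [← ENNReal.ofReal_toReal hfin.ne, ← ENNReal.ofReal_natCast,
    ← ENNReal.ofReal_mul (by positivity), ENNReal.ofReal_le_ofReal_iff hm0] at h1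
  have h2 : (R / s ^ n / 2) ^ Q = (R / 2) ^ Q * Real.exp (-(Q * Real.log s * n)) := by
    rw [show R / s ^ n / 2 = R / 2 * (s ^ n)⁻¹ by ring, Real.mul_rpow (by positivity)
      (by positivity)]
    congr 1
    rw [Real.rpow_def_of_pos (by positivity), Real.log_inv, Real.log_pow]
    congr 1; ring
  have hexp : Real.exp (-(Q * Real.log s * n)) * Real.exp (Q * Real.log s * n) = 1 := by
    rw [← Real.exp_add]; simp
  have h3 : ((X.finite_centers n).toFinset.card : ℝ) ≤ B * Real.exp (Q * Real.log s * n) := by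
    rw [hB, div_mul_eq_mul_div, le_div_iff₀ (by positivity)]
    rw [h2] at h1
    calc _ = (X.finite_centers n).toFinset.card *
          (c * ((R / 2) ^ Q * Real.exp (-(Q * Real.log s * n)))) * Real.exp (Q * Real.log s * n) := by
          rw [mul_assoc, mul_assoc c, mul_assoc ((R / 2) ^ Q), hexp, mul_one]
      _ ≤ _ := by gcongr
  have h4 := card_edges_le (F := (X.finite_levelEdges n).toFinset) (n := n) (by simp)
    (V := (X.finite_centers n).toFinset) fun e he => by
      simpa using endCenters_mem (by simpa using he)
  calc ((X.finite_levelEdges n).toFinset.card : ℝ)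
      ≤ ((X.finite_centers n).toFinset.card : ℝ) ^ 2 := by exact_mod_cast h4
    _ ≤ (B * Real.exp (Q * Real.log s * n)) ^ 2 := by gcongr
    _ = B ^ 2 * Real.exp (2 * Q * Real.log s * n) := by
        rw [mul_pow, ← Real.exp_nat_mul]; congr 2; push_cast; ring
    _ ≤ _ := by gcongr; simp

end Measure

/-! ### The energy of the level densities -/

section Density

variable (X) [CompactSpace Z]

/-- The density on `Z` defined by the edges of level `n`. -/
def density (τ : X.graph.edgeSet → ℝ≥0∞) (n : ℕ) (z : Z) : ℝ≥0∞ :=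
  ∑ e ∈ (X.finite_levelEdges n).toFinset,
    (Metric.ball (endCenters e).1 (3 * (R / s ^ n))).indicator
      (fun _ => 2 * τ e / ENNReal.ofReal (R / s ^ n)) z

variable [MeasurableSpace Z] [BorelSpace Z] {μ : Measure Z} {Q c C : ℝ}

theorem measurable_density (τ : X.graph.edgeSet → ℝ≥0∞) (n : ℕ) : Measurable (X.density τ n) :=
  Finset.measurable_fun_sum _ fun _ _ => measurable_const.indicator measurableSet_ball

variable {X}

/-- Boundedly many balls of the level contain z, so the power mean inequality moves the exponent
inside the sum at bounded cost. -/
theorem density_rpow_le (hμ : IsAhlforsRegular μ Q c C) (hQ : 1 ≤ Q) (hc : 0 < c) (hC : 0 < C)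
    (τ : X.graph.edgeSet → ℝ≥0∞) {n : ℕ} (hn : 8 * (R / s ^ n) ≤ Metric.diam (univ : Set Z))
    (z : Z) :
    X.density τ n z ^ Q ≤ ENNReal.ofReal (((C / c * 16 ^ Q) ^ 2) ^ (Q - 1)) *
      ∑ e ∈ (X.finite_levelEdges n).toFinset,
        (Metric.ball (endCenters e).1 (3 * (R / s ^ n))).indicator
          (fun _ => (2 * τ e / ENNReal.ofReal (R / s ^ n)) ^ Q) z := by
  classical
  have hr := X.scale_pos n
  set E := (X.finite_levelEdges n).toFinset with hE
  set F := E.filter fun e => z ∈ Metric.ball (endCenters e).1 (3 * (R / s ^ n)) with hF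
  have hFE : ∀ e ∈ F, e ∈ X.levelEdges n := fun e he => by
    simpa [hE] using (Finset.mem_filter.1 he).1
  have hcard : (F.card : ℝ) ≤ (C / c * 16 ^ Q) ^ 2 := by
    set V := F.image (fun e => (endCenters e).1) ∪ F.image (fun e => (endCenters e).2) with hV
    have h1 : F.card ≤ V.card ^ 2 := card_edges_le hFE fun e he =>
      ⟨Finset.mem_union_left _ (Finset.mem_image_of_mem (fun e => (endCenters e).1) he),
        Finset.mem_union_right _ (Finset.mem_image_of_mem (fun e => (endCenters e).2) he)⟩
    have hdist : ∀ e ∈ F, dist (endCenters e).1 z < 3 * (R / s ^ n) := fun e he => by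
      rw [dist_comm]; exact (Finset.mem_filter.1 he).2
    have h2 : (V.card : ℝ) ≤ C / c * 16 ^ Q := by
      refine card_centers_near_le (X := X) hμ hc hC hn (z := z) (fun p hp => ?_) fun p hp => ?_
      · rcases Finset.mem_union.1 hp with hp | hp <;>
          obtain ⟨e, he, rfl⟩ := Finset.mem_image.1 hp
        exacts [(endCenters_mem (hFE e he)).1, (endCenters_mem (hFE e he)).2]
      · rcases Finset.mem_union.1 hp with hp | hp <;>
          obtain ⟨e, he, rfl⟩ := Finset.mem_image.1 hp
        · linarith [hdist e he]
        · have h3 := hdist e he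
          have h4 := dist_endCenters_le (hFE e he)
          linarith [dist_triangle_left (endCenters e).2 z (endCenters e).1]
    calc (F.card : ℝ) ≤ (V.card : ℝ) ^ 2 := by exact_mod_cast h1
      _ ≤ _ := by gcongr
  have hind : ∀ f : X.graph.edgeSet → ℝ≥0∞,
      ∑ e ∈ E, (Metric.ball (endCenters e).1 (3 * (R / s ^ n))).indicator (fun _ => f e) z =
        ∑ e ∈ F, f e := fun f => by
    rw [hF, Finset.sum_filter]
    exact Finset.sum_congr rfl fun e _ => by rw [indicator_apply]
  rw [density, hind, hind]
  refine (ENNReal.rpow_sum_le_const_mul_sum_rpow _ _ hQ).trans ?_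
  gcongr
  rw [← ENNReal.ofReal_natCast,
    ENNReal.ofReal_rpow_of_nonneg (by positivity) (by linarith)]
  exact ENNReal.ofReal_le_ofReal (Real.rpow_le_rpow (by positivity) hcard (by linarith))

theorem lintegral_density_rpow_le (hμ : IsAhlforsRegular μ Q c C) (hQ : 1 ≤ Q) (hc : 0 < c)
    (hC : 0 < C) (τ : X.graph.edgeSet → ℝ≥0∞) {n : ℕ}
    (hn : 8 * (R / s ^ n) ≤ Metric.diam (univ : Set Z)) :
    ∫⁻ z, X.density τ n z ^ Q ∂μ ≤
      ENNReal.ofReal (((C / c * 16 ^ Q) ^ 2) ^ (Q - 1) * (C * 6 ^ Q)) *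
        ∑ e ∈ (X.finite_levelEdges n).toFinset, τ e ^ Q := by
  have hr := X.scale_pos n
  have hQ0 : 0 ≤ Q := by linarith
  calc ∫⁻ z, X.density τ n z ^ Q ∂μ
      ≤ ∫⁻ z, ENNReal.ofReal (((C / c * 16 ^ Q) ^ 2) ^ (Q - 1)) *
        ∑ e ∈ (X.finite_levelEdges n).toFinset,
          (Metric.ball (endCenters e).1 (3 * (R / s ^ n))).indicator
            (fun _ => (2 * τ e / ENNReal.ofReal (R / s ^ n)) ^ Q) z ∂μ :=
        lintegral_mono fun z => density_rpow_le hμ hQ hc hC τ hn z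
    _ = ENNReal.ofReal (((C / c * 16 ^ Q) ^ 2) ^ (Q - 1)) *
        ∑ e ∈ (X.finite_levelEdges n).toFinset, (2 * τ e / ENNReal.ofReal (R / s ^ n)) ^ Q *
          μ (Metric.ball (endCenters e).1 (3 * (R / s ^ n))) := by
        rw [lintegral_const_mul _ (Finset.measurable_fun_sum _ fun _ _ =>
          measurable_const.indicator measurableSet_ball), lintegral_finsetSum _ fun _ _ =>
          measurable_const.indicator measurableSet_ball]
        congr 1
        exact Finset.sum_congr rfl fun e _ => lintegral_indicator_const measurableSet_ball _
    _ ≤ ENNReal.ofReal (((C / c * 16 ^ Q) ^ 2) ^ (Q - 1)) *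
        ∑ e ∈ (X.finite_levelEdges n).toFinset, ENNReal.ofReal (C * 6 ^ Q) * τ e ^ Q := by
        refine mul_le_mul' le_rfl (Finset.sum_le_sum fun e _ => ?_)
        calc (2 * τ e / ENNReal.ofReal (R / s ^ n)) ^ Q *
              μ (Metric.ball (endCenters e).1 (3 * (R / s ^ n)))
            ≤ (ENNReal.ofReal (2 / (R / s ^ n)) * τ e) ^ Q *
              ENNReal.ofReal (C * (3 * (R / s ^ n)) ^ Q) := by
              gcongr
              · rw [ENNReal.ofReal_div_of_pos hr, ENNReal.ofReal_ofNat,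
                  ENNReal.mul_div_right_comm]
              · exact (hμ _ _ (by linarith) (by linarith)).2
          -- The scale cancels: `(2 / r) ^ Q * (3 * r) ^ Q = 6 ^ Q`, because the exponent is the
          -- dimension.
          _ = _ := by
              rw [ENNReal.mul_rpow_of_nonneg _ _ hQ0, mul_right_comm,
                ENNReal.ofReal_rpow_of_nonneg (by positivity) hQ0,
                ← ENNReal.ofReal_mul (by positivity)]
              congr 2
              rw [mul_left_comm, ← Real.mul_rpow (by positivity) (by positivity)]
              congr 2
              rw [div_mul_eq_mul_div, div_eq_iff hr.ne']
              ring
    _ = _ := by rw [← Finset.mul_sum, ← mul_assoc, ← ENNReal.ofReal_mul (by positivity)]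

end Density

end HyperbolicFilling

/-! ### Sets that contain points at all small distances -/

section FillsRadii

variable {Z : Type*} [MetricSpace Z]

/-- The distances from `a` to the points of `A` fill an interval `[0, δ)`. -/
def FillsRadii (A : Set Z) (a : Z) : Prop :=
  ∃ δ : ℝ, 0 < δ ∧ ∀ t ∈ Ico 0 δ, ∃ z ∈ A, dist a z = t

theorem _root_.IsPreconnected.exists_dist_eq {S : Set Z} (hS : IsPreconnected S) {a b : Z}
    (ha : a ∈ S) (hb : b ∈ S) {t : ℝ} (ht : t ∈ Ico 0 (dist a b)) : ∃ z ∈ S, dist a z = t :=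
  hS.intermediate_value ha hb (continuous_const.dist continuous_id).continuousOn
    ⟨by simpa using ht.1, ht.2.le⟩

/-- Connectedness of Z gives points at all distances below `dist a b`, and openness puts the close
ones in A. -/
theorem fillsRadii_of_isOpen [ConnectedSpace Z] {A : Set Z} (hA : IsOpen A) {a b : Z}
    (ha : a ∈ A) (hab : a ≠ b) : FillsRadii A a := by
  obtain ⟨ε, hε, hball⟩ := Metric.isOpen_iff.1 hA a ha
  refine ⟨min ε (dist a b), lt_min hε (dist_pos.2 hab), fun t ht => ?_⟩
  obtain ⟨z, -, hz⟩ := isPreconnected_univ.exists_dist_eq (mem_univ a) (mem_univ b)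
    ⟨ht.1, ht.2.trans_le (min_le_right _ _)⟩
  refine ⟨z, hball ?_, hz⟩
  rw [Metric.mem_ball, dist_comm, hz]
  exact ht.2.trans_le (min_le_left _ _)

theorem IsContinuum.fillsRadii {A : Set Z} (hA : IsContinuum A) {a : Z} (ha : a ∈ A) :
    FillsRadii A a := by
  obtain ⟨b, hb, hba⟩ := hA.2.2.exists_ne a
  exact ⟨dist a b, dist_pos.2 hba.symm, fun t ht =>
    hA.2.1.isPreconnected.exists_dist_eq ha hb ht⟩

theorem disjoint_of_setEDist_pos {A B : Set Z} (h : 0 < setEDist A B) : Disjoint A B := by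
  refine Set.disjoint_left.2 fun z hzA hzB => h.ne' ?_
  refine le_antisymm ?_ zero_le
  exact (iInf₂_le z hzA).trans ((iInf₂_le z hzB).trans_eq (edist_self z))

end FillsRadii

/-! ### Admissibility along a path and the final estimate -/

namespace HyperbolicFilling

variable {Z : Type*} [MetricSpace Z] {s R : ℝ} {X : HyperbolicFilling Z s R}

theorem near_mem_trace {Γ : Set Z} {n : ℕ} {a z : Z} (ha : a ∈ Γ) (h : dist a z < R / s ^ n) :
    X.near n z ∈ X.trace Γ n := by
  refine ⟨rfl, a, ?_, ha⟩
  rw [ball, Metric.mem_ball, radius, level_near]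
  linarith [X.dist_center_near n z, dist_triangle a z (center (X.near n z))]

variable [CompactSpace Z]

/-- For an edge in F the path meets the ball of radius 2 scales about the chosen center and leaves
that of radius 3. It spends at least one scale of length there and collects `2 * τ e`; the factor 2
compensates the 1/2. -/
theorem one_le_lineIntegral_density {τ : X.graph.edgeSet → ℝ≥0∞} {γ : Curve Z}
    (hγ : γ.Rectifiable) {n : ℕ}
    (hn : 6 * (R / s ^ n) ≤ dist (γ.toFun γ.a) (γ.toFun γ.b)) {F : Finset X.graph.edgeSet}
    (hF : ∀ e ∈ F, ∀ x ∈ e.1, x ∈ X.trace (γ.toFun '' Icc γ.a γ.b) n)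
    (hsum : ENNReal.ofReal (1 / 2) ≤ ∑ e ∈ F, τ e) : 1 ≤ γ.lineIntegral (X.density τ n) := by
  have hr := X.scale_pos n
  have hr' : ENNReal.ofReal (R / s ^ n) ≠ 0 := by simpa using hr
  have hFE : F ⊆ (X.finite_levelEdges n).toFinset := fun e he => by
    rw [Set.Finite.mem_toFinset]
    exact fun x hx => (hF e he x hx).1
  have hedge : ∀ e ∈ F, 2 * τ e ≤ γ.lineIntegral
      ((Metric.ball (endCenters e).1 (3 * (R / s ^ n))).indicator
        fun _ => 2 * τ e / ENNReal.ofReal (R / s ^ n)) := by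
    intro e he
    obtain ⟨hl, _, hball, x, hx, rfl⟩ := hF e he _ (Sym2.out_fst_mem _)
    rw [ball, Metric.mem_ball, radius, hl] at hball
    -- Otherwise both ends of the path would lie within 3 scales of the center, hence less than 6
    -- scales apart.
    obtain ⟨y, hy, hyz⟩ : ∃ y ∈ Icc γ.a γ.b,
        3 * (R / s ^ n) ≤ dist (γ.toFun y) (endCenters e).1 := by
      by_contra! hcon
      have h1 := hcon γ.a (left_mem_Icc.2 γ.le)
      have h2 := hcon γ.b (right_mem_Icc.2 γ.le)
      linarith [dist_triangle_right (γ.toFun γ.a) (γ.toFun γ.b) (endCenters e).1]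
    have h := Curve.le_lineIntegral_indicator_ball hγ hx hy hball.le hyz
      (2 * τ e / ENNReal.ofReal (R / s ^ n))
    rwa [show 3 * (R / s ^ n) - 2 * (R / s ^ n) = R / s ^ n by ring,
      ENNReal.div_mul_cancel hr' ENNReal.ofReal_ne_top] at h
  calc (1 : ℝ≥0∞) = 2 * ENNReal.ofReal (1 / 2) := by
        rw [← ENNReal.ofReal_ofNat, ← ENNReal.ofReal_mul (by norm_num)]; norm_num
    _ ≤ 2 * ∑ e ∈ F, τ e := by gcongr
    _ = ∑ e ∈ F, 2 * τ e := Finset.mul_sum _ _ _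
    _ ≤ ∑ e ∈ F, γ.lineIntegral ((Metric.ball (endCenters e).1 (3 * (R / s ^ n))).indicator
          fun _ => 2 * τ e / ENNReal.ofReal (R / s ^ n)) := Finset.sum_le_sum hedge
    _ ≤ ∑ e ∈ (X.finite_levelEdges n).toFinset,
          γ.lineIntegral ((Metric.ball (endCenters e).1 (3 * (R / s ^ n))).indicator
            fun _ => 2 * τ e / ENNReal.ofReal (R / s ^ n)) := Finset.sum_le_sum_of_subset hFE
    _ ≤ γ.lineIntegral (X.density τ n) := Curve.sum_lineIntegral_le _ _

/-- The densities of an admissible function are eventually admissible for a given path. -/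
theorem Admissible.eventually_one_le_lineIntegral {A B : Set Z} {τ : X.graph.edgeSet → ℝ≥0∞}
    (hτ : X.Admissible A B τ) {Q : ℝ} (hQ : 0 < Q) {K : ℝ≥0} (hK : WeakBound Q τ K)
    {γ : Curve Z} (hγ : γ.Rectifiable) (hab : γ.toFun γ.a ≠ γ.toFun γ.b)
    (hA : FillsRadii A (γ.toFun γ.a)) (hB : FillsRadii B (γ.toFun γ.b)) :
    ∃ N, ∀ n, N ≤ n → 1 ≤ γ.lineIntegral (X.density τ n) := by
  obtain ⟨δ, hδ, hA⟩ := hA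
  obtain ⟨ε, hε, hB⟩ := hB
  obtain ⟨N, hN⟩ := exists_tsum_rayEdge_le hQ hK
  have h6 : 0 < dist (γ.toFun γ.a) (γ.toFun γ.b) / 6 := div_pos (dist_pos.2 hab) (by norm_num)
  obtain ⟨N', hN'⟩ := eventually_atTop.1
    (X.tendsto_scale.eventually_lt_const (lt_min h6 (lt_min hδ hε)))
  refine ⟨max N N', fun n hn => ?_⟩
  have hsmall := hN' n ((le_max_right _ _).trans hn)
  have hn1 := hsmall.trans_le (min_le_left _ _)
  have hn2 := hsmall.trans_le ((min_le_right _ _).trans (min_le_left _ _))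
  have hn3 := hsmall.trans_le ((min_le_right _ _).trans (min_le_right _ _))
  have hNn := hN n ((le_max_left _ _).trans hn)
  obtain ⟨z, hz, haz, hzsum⟩ := hNn A _ fun t ht => hA t ⟨ht.1, ht.2.trans hn2⟩
  obtain ⟨w, hw, hbw, hwsum⟩ := hNn B _ fun t ht => hB t ⟨ht.1, ht.2.trans hn3⟩
  have hΓ : IsPreconnected (γ.toFun '' Icc γ.a γ.b) := isPreconnected_Icc.image _ γ.cont
  have hfin : {e : X.graph.edgeSet |
      ∀ x ∈ e.1, x ∈ X.trace (γ.toFun '' Icc γ.a γ.b) n}.Finite :=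
    (X.finite_levelEdges n).subset fun e he x hx => (he x hx).1
  refine one_le_lineIntegral_density hγ (by linarith) (F := hfin.toFinset) (by simp) ?_
  exact hτ.half_le_sum hΓ hz hw
    (near_mem_trace (mem_image_of_mem _ (left_mem_Icc.2 γ.le)) haz)
    (near_mem_trace (mem_image_of_mem _ (right_mem_Icc.2 γ.le)) hbw) hzsum hwsum (by simp)

variable [MeasurableSpace Z] [BorelSpace Z] {μ : Measure Z} {Q c C : ℝ}

/-- The radii conditions are required only when both sets have a point, as an open set needs a
second point of Z to fill radii. -/
theorem Admissible.setModulus_le (hμ : IsAhlforsRegular μ Q c C) (hQ : 1 < Q) (hc : 0 < c)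
    (hC : 0 < C) {A B : Set Z} {τ : X.graph.edgeSet → ℝ≥0∞} (hτ : X.Admissible A B τ)
    (hAB : Disjoint A B)
    (hA : ∀ a ∈ A, ∀ b ∈ B, FillsRadii A a) (hB : ∀ a ∈ A, ∀ b ∈ B, FillsRadii B b)
    {K : ℝ≥0} (hK0 : 0 < K) (hK : WeakBound Q τ K) :
    setModulus μ Q A B ≤ ENNReal.ofReal
      (((C / c * 16 ^ Q) ^ 2) ^ (Q - 1) * (C * 6 ^ Q) * (2 * (2 * Q * Real.log s))) *
        (K : ℝ≥0∞) ^ Q := by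
  have hQ0 : 0 < Q := by linarith
  rcases (connecting A B).eq_empty_or_nonempty with hempty | ⟨γ₀, hγ₀⟩
  · have h0 : setModulus μ Q A B ≤ ∫⁻ _, (0 : ℝ≥0∞) ^ Q ∂μ :=
      iInf₂_le (fun _ => 0) ⟨measurable_const, fun γ hγ => by simp [hempty] at hγ⟩
    rw [ENNReal.zero_rpow_of_pos hQ0, lintegral_zero] at h0
    exact h0.trans zero_le
  have hne : ∀ γ ∈ connecting A B, γ.toFun γ.a ≠ γ.toFun γ.b := fun γ hγ h =>
    Set.disjoint_left.1 hAB hγ.1 (h ▸ hγ.2)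
  have hd : 0 < Metric.diam (univ : Set Z) := (dist_pos.2 (hne γ₀ hγ₀)).trans_le
    (Metric.dist_le_diam_of_mem isCompact_univ.isBounded (mem_univ _) (mem_univ _))
  -- The level from which the densities work depends on the path, so paths are grouped by it;
  -- nonrectifiable paths impose no condition.
  let Γ : ℕ → Set (Curve Z) := fun j =>
    {γ ∈ connecting A B | γ.Rectifiable → ∀ n, j ≤ n → 1 ≤ γ.lineIntegral (X.density τ n)}
  have hΓ : Monotone Γ := fun i j hij γ hγ => ⟨hγ.1, fun hr n hn => hγ.2 hr n (hij.trans hn)⟩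
  have hunion : connecting A B = ⋃ j, Γ j := by
    refine Subset.antisymm (fun γ hγ => ?_) (iUnion_subset fun j γ hγ => hγ.1)
    by_cases hr : γ.Rectifiable
    · obtain ⟨N, hN⟩ := hτ.eventually_one_le_lineIntegral hQ0 hK hr (hne γ hγ)
        (hA _ hγ.1 _ hγ.2) (hB _ hγ.1 _ hγ.2)
      exact mem_iUnion.2 ⟨N, hγ, fun _ => hN⟩
    · exact mem_iUnion.2 ⟨0, hγ, fun h => absurd h hr⟩
  rw [setModulus, hunion]
  refine modulus_iUnion_le hQ hΓ fun j => ?_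
  obtain ⟨N, hN⟩ := eventually_atTop.1
    (X.tendsto_scale.eventually_lt_const (show 0 < Metric.diam (univ : Set Z) / 8 by positivity))
  obtain ⟨D, hD, hcard⟩ := exists_card_levelEdges_le (X := X) hμ hc hd
  have hlog := Real.log_pos X.one_lt
  have hdisj : Pairwise fun m n => Disjoint (X.finite_levelEdges m).toFinset
      (X.finite_levelEdges n).toFinset := by
    refine fun m n hmn => Finset.disjoint_left.2 fun e hem hen => hmn ?_
    rw [Set.Finite.mem_toFinset] at hem hen
    rw [← hem _ (Sym2.out_fst_mem _), hen _ (Sym2.out_fst_mem _)]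
  -- One good level past j serves all of `Γ j`; it may vary with j, but its energy bound does not.
  obtain ⟨n, hn, hsum⟩ := hK.exists_sum_rpow_le hQ0 hK0 hdisj hD
    (show 0 < 2 * Q * Real.log s by positivity) (j := max j N) fun n hn =>
      hcard n (by
        have := hN n ((le_max_right _ _).trans hn)
        linarith [X.scale_pos n])
  have hn8 : 8 * (R / s ^ n) ≤ Metric.diam (univ : Set Z) := by
    linarith [hN n ((le_max_right _ _).trans hn)]
  calc modulus μ Q (Γ j) ≤ ∫⁻ z, X.density τ n z ^ Q ∂μ :=
        iInf₂_le _ ⟨X.measurable_density τ n, fun γ hγ hr =>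
          hγ.2 hr n ((le_max_left _ _).trans hn)⟩
    _ ≤ _ := lintegral_density_rpow_le hμ hQ.le hc hC τ hn8
    _ ≤ ENNReal.ofReal (((C / c * 16 ^ Q) ^ 2) ^ (Q - 1) * (C * 6 ^ Q)) *
        (ENNReal.ofReal (2 * (2 * Q * Real.log s)) * (K : ℝ≥0∞) ^ Q) := by gcongr
    _ = _ := by rw [← mul_assoc, ← ENNReal.ofReal_mul (by positivity)]

theorem setModulus_le_wcap (hμ : IsAhlforsRegular μ Q c C) (hQ : 1 < Q) (hc : 0 < c)
    (hC : 0 < C) {A B : Set Z} (hAB : Disjoint A B)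
    (hA : ∀ a ∈ A, ∀ b ∈ B, FillsRadii A a) (hB : ∀ a ∈ A, ∀ b ∈ B, FillsRadii B b) :
    setModulus μ Q A B ≤ ENNReal.ofReal
      (((C / c * 16 ^ Q) ^ 2) ^ (Q - 1) * (C * 6 ^ Q) * (2 * (2 * Q * Real.log s))) *
        X.wcap Q A B := by
  have hQ0 : 0 < Q := by linarith
  set L := ((C / c * 16 ^ Q) ^ 2) ^ (Q - 1) * (C * 6 ^ Q) * (2 * (2 * Q * Real.log s)) with hL
  have hlog := Real.log_pos X.one_lt
  have hL0 : ENNReal.ofReal L ≠ 0 := by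
    have : 0 < L := by positivity
    simpa using this
  rw [mul_comm, ← ENNReal.div_le_iff hL0 ENNReal.ofReal_ne_top]
  refine le_iInf₂ fun τ hτ => ?_
  have h1 : (setModulus μ Q A B / ENNReal.ofReal L) ^ Q⁻¹ ≤ weakNorm Q τ := by
    refine le_iInf₂ fun K hK => ?_
    rw [ENNReal.rpow_inv_le_iff hQ0, ENNReal.div_le_iff hL0 ENNReal.ofReal_ne_top, mul_comm]
    exact hτ.setModulus_le hμ hQ hc hC hAB hA hB hK.1 hK.2
  exact (ENNReal.rpow_inv_le_iff hQ0).1 h1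

end HyperbolicFilling

end WeakCap

end

theorem theorem1p1 (Q s c C : ℝ) (hQ : 1 < Q) (hs : 1 < s) (hc : 0 < c) (hC : 0 < C) :
    ∃ K : ℝ, 0 < K ∧
      ∀ (Z : Type*) [MetricSpace Z] [CompactSpace Z] [ConnectedSpace Z]
        [MeasurableSpace Z] [BorelSpace Z] (μ : MeasureTheory.Measure Z),
        WeakCap.IsAhlforsRegular μ Q c C →
        ∀ (R : ℝ) (X : WeakCap.HyperbolicFilling Z s R) (A B : Set Z),
          ((IsOpen A ∧ IsOpen B ∧ 0 < WeakCap.setEDist A B) ∨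
            (WeakCap.IsContinuum A ∧ WeakCap.IsContinuum B ∧ Disjoint A B)) →
          WeakCap.setModulus μ Q A B ≤ ENNReal.ofReal K * X.wcap Q A B := by
  have hlog := Real.log_pos hs
  refine ⟨((C / c * 16 ^ Q) ^ 2) ^ (Q - 1) * (C * 6 ^ Q) * (2 * (2 * Q * Real.log s)),
    by positivity, ?_⟩
  intro Z _ _ _ _ _ μ hμ R X A B hAB
  -- Either alternative enters only through disjointness and the filling of radii.
  rcases hAB with ⟨hA, hB, hd⟩ | ⟨hA, hB, hd⟩
  · have hdisj := WeakCap.disjoint_of_setEDist_pos hd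
    exact WeakCap.HyperbolicFilling.setModulus_le_wcap hμ hQ hc hC hdisj
      (fun a ha b hb => WeakCap.fillsRadii_of_isOpen hA ha (hdisj.ne_of_mem ha hb))
      (fun a ha b hb => WeakCap.fillsRadii_of_isOpen hB hb (hdisj.ne_of_mem ha hb).symm)
  · exact WeakCap.HyperbolicFilling.setModulus_le_wcap hμ hQ hc hC hd
      (fun a ha _ _ => hA.fillsRadii ha) (fun _ _ b hb => hB.fillsRadii hb)
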